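/- Let $n\ge 1$, let $J\subset\mathbb R$ be an interval, $I=[a,b]\subset J$ with $a<b$, and let $f:J\to\mathbb R^{n+1}$ be a curve with speed $\nu=\|f'\|>0$ and with a Frenet frame $V_1,\dots,V_{n+1}$ along $f$, in one of the following two senses. (1) (Usual frame.) $f$ is of class $C^{n+1}$ and $n$-regular, i.e. $f',f'',\dots,f^{(n)}$ are linearly independent at every point of $J$; $V_1,\dots,V_n$ are obtained from $f',\dots,f^{(n)}$ by the Gram–Schmidt process, and $V_{n+1}$ completes them to a positively oriented orthonormal basis of $\mathbb R^{n+1}$. (2) (Extended frame, e.g. for straight lines or plane curves in $\mathbb R^3$.) For some $1\le m<n$, $f$ is of class $C^{m+1}$ and $f',\dots,f^{(m)}$ are linearly independent at every point of $J$; $V_1,\dots,V_m$ are obtained from them by the Gram–Schmidt process, $V_{m+2},\dots,V_{n+1}$ are constant, $V_{m+1}$ is continuous, and $V_1,\dots,V_{n+1}$ are orthonormal at every point of $J$. Let $\kappa_1=\langle V_1',V_2\rangle/\nu$ be the first curvature, let $R>0$ be a constant, put $$G(x_1,\dots,x_n,t)=f(t)+\sum_{j=1}^n x_jV_{j+1}(t),\qquad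 \Omega_I=\{(X,t)\in\mathbb R^n\times I:\ \|X\|\le R\},$$ and suppose that $G$ is injective on $\Omega_I$ and that $\nu(t)\,(1-x_1\kappa_1(t))>0$ for all $(x_1,\dots,x_n,t)\in\Omega_I$. Let $$\partial_l\Gamma=G\bigl(\{(RX,t):\ X\in\mathbb S^{n-1},\ t\in I\}\bigr)$$ be the lateral hypersurface (sphere tube of constant radius $R$ around $f$), where $\mathbb S^{n-1}$ is the unit sphere of $\mathbb R^n$. Then $$\operatorname{vol}(\partial_l\Gamma)=\operatorname{vol}\bigl(\mathbb S^{n-1}(R)\bigr)\cdot\int_a^b\nu(t)\,dt ,$$ that is, the $n$-dimensional volume of $\partial_l\Gamma$ is the $(n-1)$-dimensional volume of the sphere $\mathbb S^{n-1}(R)$ of radius $R$ centered at the origin of $\mathbb R^n$ times the length of the axis curve $f$ from $t=a$ to $t=b$. Here $k$-dimensional volume is $k$-dimensional Hausdorff measure, normalised to agree with Lebesgue measure on $\mathbb R^k$ (for $k=0$ it counts points). -/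

import Mathlib

open Set MeasureTheory

open scoped ContDiff

noncomputable section

/-- The Euclidean space `ℝᵈ`. -/
abbrev Euc (d : ℕ) : Type := EuclideanSpace ℝ (Fin d)

/-- The speed `ν(t) = ‖f'(t)‖` of a curve `f` defined on the interval `J`. -/
def speed {d : ℕ} (f : ℝ → Euc d) (J : Set ℝ) (t : ℝ) : ℝ :=
  ‖derivWithin f J t‖

/-- The length of arc of `f` (a curve defined on `J`) from `t = a` to `t = b`. -/
def arcLength {d : ℕ} (f : ℝ → Euc d) (J : Set ℝ) (a b : ℝ) : ℝ :=
  ∫ t in a..b, speed f J t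

/-- `f` is `m`-regular on `J`: the derivatives `f', f'', …, f⁽ᵐ⁾` are linearly independent at
every point of `J`. -/
def IsRegularOfOrder {d : ℕ} (f : ℝ → Euc d) (J : Set ℝ) (m : ℕ) : Prop :=
  ∀ t ∈ J, LinearIndependent ℝ (fun i : Fin m => iteratedDerivWithin (i.val + 1) f J t)

/-- `V` (with `V 0, …, V n` standing for `V₁, …, Vₙ₊₁`) is a Frenet frame along the curve
`f : J → ℝⁿ⁺¹`, of order `m`, where `1 ≤ m ≤ n`.

* For `m = n` this is the usual Frenet frame of an `n`-regular curve: `V₁, …, Vₙ` result from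
  `f', …, f⁽ⁿ⁾` by the Gram-Schmidt process, and `Vₙ₊₁` completes them to a positively oriented
  orthonormal basis.
* For `m < n` this is the extended Frenet frame of an `m`-regular curve whose trace lies in an
  affine subspace of dimension `m + 1` (a straight line, a plane curve in `ℝ³`, …):
  `V₁, …, Vₘ` result from `f', …, f⁽ᵐ⁾` by the Gram-Schmidt process, `Vₘ₊₂, …, Vₙ₊₁` are
  constant, and `Vₘ₊₁` is a continuous field which completes them to an orthonormal basis. -/
structure IsFrenetFrameOfOrder {n : ℕ} (m : ℕ) (f : ℝ → Euc (n + 1)) (J : Set ℝ)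
    (V : Fin (n + 1) → ℝ → Euc (n + 1)) : Prop where
  one_le : 1 ≤ m
  le : m ≤ n
  smooth : ContDiffOn ℝ (m + 1) f J
  regular : IsRegularOfOrder f J m
  orthonormal : ∀ t ∈ J, Orthonormal ℝ (fun j => V j t)
  gramSchmidt : ∀ t ∈ J, ∀ i : Fin m,
    V ⟨i.val, by have := i.isLt; omega⟩ t =
      InnerProductSpace.gramSchmidtNormed ℝ
        (fun k : Fin m => iteratedDerivWithin (k.val + 1) f J t) i
  oriented : m = n → ∀ t ∈ J, 0 < (Matrix.of (fun i j => V j t i)).det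
  continuous : m < n → ContinuousOn (V ⟨m, by omega⟩) J
  constant : ∀ j : Fin (n + 1), m < j.val → ∀ s ∈ J, ∀ t ∈ J, V j s = V j t

/-- `V` is a Frenet frame along the curve `f : J → ℝⁿ⁺¹` (usual or extended). -/
def IsFrenetFrame {n : ℕ} (f : ℝ → Euc (n + 1)) (J : Set ℝ)
    (V : Fin (n + 1) → ℝ → Euc (n + 1)) : Prop :=
  ∃ m : ℕ, IsFrenetFrameOfOrder m f J V

/-- The curvatures of `f` with respect to the frame `V`, from the Frenet equations:
`κⱼ = ⟨Vⱼ', Vⱼ₊₁⟩ / ν`. The first curvature `κ₁` is `frenetCurvature f J V 0`. -/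
def frenetCurvature {n : ℕ} (f : ℝ → Euc (n + 1)) (J : Set ℝ)
    (V : Fin (n + 1) → ℝ → Euc (n + 1)) (j : Fin n) (t : ℝ) : ℝ :=
  inner ℝ (derivWithin (V j.castSucc) J t) (V j.succ t) / speed f J t

/-- The map `G(x₁, …, xₙ, t) = f(t) + ∑ xⱼ Vⱼ₊₁(t)`. -/
def tubeMap {n : ℕ} (f : ℝ → Euc (n + 1)) (V : Fin (n + 1) → ℝ → Euc (n + 1))
    (q : Euc n × ℝ) : Euc (n + 1) :=
  f q.2 + ∑ j : Fin n, q.1 j • V j.succ q.2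

/-- The solid of revolution `Ω_I = {(X, t) : ‖X‖ ≤ R(t), t ∈ [a, b]}`. -/
def diskSolid (n : ℕ) (R : ℝ → ℝ) (a b : ℝ) : Set (Euc n × ℝ) :=
  {q | ‖q.1‖ ≤ R q.2 ∧ q.2 ∈ Icc a b}

/-- The lateral hypersurface `∂ₗΩ_I = {(R(t) X, t) : X ∈ Sⁿ⁻¹, t ∈ [a, b]}`. -/
def lateralSolid (n : ℕ) (R : ℝ → ℝ) (a b : ℝ) : Set (Euc n × ℝ) :=
  {q | ∃ X ∈ Metric.sphere (0 : Euc n) 1, ∃ t ∈ Icc a b, q = (R t • X, t)}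

/-- The sphere tube `∂ₗΓ = G(∂ₗΩ_I)`, the lateral hypersurface of the disk tube `Γ = G(Ω_I)`. -/
def sphereTube {n : ℕ} (f : ℝ → Euc (n + 1)) (V : Fin (n + 1) → ℝ → Euc (n + 1))
    (R : ℝ → ℝ) (a b : ℝ) : Set (Euc (n + 1)) :=
  tubeMap f V '' lateralSolid n R a b

/-- The disk tube of radius `R(t)` is genuine: `G` is injective on `Ω_I`. -/
def IsGenuine {n : ℕ} (f : ℝ → Euc (n + 1)) (V : Fin (n + 1) → ℝ → Euc (n + 1))
    (R : ℝ → ℝ) (a b : ℝ) : Prop :=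
  InjOn (tubeMap f V) (diskSolid n R a b)

/-- The fundamental regularity condition `ν(t) (1 - x₁ κ₁(t)) > 0` on `Ω_I`. -/
def FundamentalRegularity {n : ℕ} [NeZero n] (f : ℝ → Euc (n + 1)) (J : Set ℝ)
    (V : Fin (n + 1) → ℝ → Euc (n + 1)) (R : ℝ → ℝ) (a b : ℝ) : Prop :=
  ∀ q ∈ diskSolid n R a b, 0 < speed f J q.2 * (1 - q.1 0 * frenetCurvature f J V 0 q.2)

/-- The `k`-dimensional volume of a subset of `ℝᵈ`: the `k`-dimensional Hausdorff measure,
normalised so that it is Lebesgue measure on `k`-dimensional Euclidean space (on a `k`-dimensional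
submanifold it is the Riemannian volume, with volume element `√det (gᵢⱼ) du₁ ⋯ duₖ`). -/
def kVolume (k : ℕ) {d : ℕ} (S : Set (Euc d)) : ENNReal :=
  Measure.euclideanHausdorffMeasure k S

end

open Filter Topology Asymptotics
open scoped NNReal ENNReal RealInnerProductSpace

/-! At `(X, t)` the differential of `G` sends `(v, s)` to `W v + s (W c + y)`, where `W` maps `ℝⁿ`
isometrically onto the normal space of the curve. The vector `c` is orthogonal to `X` because `∑ xⱼ
Vⱼ₊₁` has constant length and `f'` is orthogonal to it, so `W c` only shears along the sphere. The
remaining part is `y = ν (1 - x₁ κ₁) V₁`, since `V₁'` has no component beyond `V₂`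
(`inner_derivWithin_zero`). Hence the volume factor on sphere times interval is `ν (1 - x₁ κ₁)`. Its
linear term integrates to zero by the antipodal map (`lintegral_sphere_affine`), which leaves the
integral of `ν`.

The area formula (`volume_image_sphere_prod`) comes from `local_volume_comparison`: near a point,
`G` is bi-Lipschitz close, with constant `C > 1`, to a linear map composed with projection to the
tangent hyperplane of the sphere. Countable patching and `C → 1` give equality. Strict
differentiability of `G` requires every frame vector to be `C¹`, including the one not produced by
Gram–Schmidt (`IsFrenetFrameOfOrder.contDiffOn`). -/

/-! ### Hausdorff measure and comparison of increments -/

theorem euclideanHausdorffMeasure_image_le_of_dist_le {Z X Y : Type*} [MetricSpace X]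
    [MeasurableSpace X] [BorelSpace X] [MetricSpace Y] [MeasurableSpace Y] [BorelSpace Y]
    (g : Z → X) (h : Z → Y) (A : Set Z) (K : ℝ≥0) (d : ℕ)
    (H : ∀ z ∈ A, ∀ z' ∈ A, dist (g z) (g z') ≤ K * dist (h z) (h z')) :
    μHE[d] (g '' A) ≤ (K : ℝ≥0∞) ^ d * μHE[d] (h '' A) := by
  rcases A.eq_empty_or_nonempty with rfl | ⟨z₀, hz₀⟩
  · simp
  have : Nonempty Z := ⟨z₀⟩
  -- The bound forces `g` to factor through `h` on `A`, even if `h` is not injective; the factor `φ`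
  -- is `K`-Lipschitz.
  let φ : Y → X := fun y => g (Function.invFunOn h A y)
  have hφ : ∀ z ∈ A, φ (h z) = g z := by
    intro z hz
    have hex : ∃ z' ∈ A, h z' = h z := ⟨z, hz, rfl⟩
    have := H _ (Function.invFunOn_mem hex) z hz
    rw [Function.invFunOn_eq hex, dist_self, mul_zero] at this
    exact dist_le_zero.1 this
  have himg : g '' A = φ '' (h '' A) := by
    rw [image_image]
    exact image_congr fun z hz => (hφ z hz).symm
  have hlip : LipschitzOnWith K φ (h '' A) := by
    refine LipschitzOnWith.of_dist_le_mul ?_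
    rintro _ ⟨z, hz, rfl⟩ _ ⟨z', hz', rfl⟩
    rw [hφ z hz, hφ z' hz']
    exact H z hz z' hz'
  have := hlip.hausdorffMeasure_image_le (d := d) (by positivity)
  rw [himg, Measure.euclideanHausdorffMeasure_def, Measure.euclideanHausdorffMeasure_def,
    Measure.smul_apply, Measure.smul_apply, ENNReal.smul_def, ENNReal.smul_def, smul_eq_mul,
    smul_eq_mul, mul_left_comm]
  gcongr
  simpa using this

/-- If the increments of `g` are approximated by `T` applied to the increments of `h`, and `T` is
injective on a finite-dimensional space, then the increments of `g` and of `T ∘ h` are comparable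
up to constants arbitrarily close to one. -/
theorem eventually_norm_sub_le_of_isLittleO {Z E F : Type*} [NormedAddCommGroup E]
    [NormedSpace ℝ E] [FiniteDimensional ℝ E] [NormedAddCommGroup F] [NormedSpace ℝ F]
    {l : Filter (Z × Z)} {g : Z → F} {h : Z → E} {T : E →L[ℝ] F} (hT : Function.Injective T)
    (H : (fun p : Z × Z => g p.1 - g p.2 - T (h p.1 - h p.2)) =o[l] fun p => h p.1 - h p.2)
    {C : ℝ} (hC : 1 < C) :
    ∀ᶠ p in l, ‖g p.1 - g p.2‖ ≤ C * ‖T (h p.1 - h p.2)‖ ∧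
      ‖T (h p.1 - h p.2)‖ ≤ C * ‖g p.1 - g p.2‖ := by
  obtain ⟨K, hK, hanti⟩ := (LinearMap.injective_iff_antilipschitz T.toLinearMap).1 hT
  have hO : (fun p : Z × Z => h p.1 - h p.2) =O[l] fun p => T (h p.1 - h p.2) := by
    refine IsBigO.of_bound K (Eventually.of_forall fun p => ?_)
    simpa using hanti.le_mul_dist (h p.1 - h p.2) 0
  -- One error level serves both bounds: `1 - ε = C⁻¹` gives the second, and `1 + ε ≤ C` (`hCC`) the
  -- first.
  have hε : 0 < 1 - C⁻¹ := by
    have := inv_lt_one_of_one_lt₀ hC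
    linarith
  filter_upwards [(H.trans_isBigO hO).bound hε] with p hp
  set u := g p.1 - g p.2
  set v := T (h p.1 - h p.2)
  have h1 : ‖u‖ ≤ ‖u - v‖ + ‖v‖ := by simpa using norm_add_le (u - v) v
  have h2 : ‖v‖ ≤ ‖u - v‖ + ‖u‖ := by
    simpa [norm_sub_rev] using norm_add_le (v - u) u
  have hC0 : 0 < C := by linarith
  have hCC : 1 - C⁻¹ ≤ C - 1 := by
    have : C⁻¹ * C = 1 := inv_mul_cancel₀ hC0.ne'
    nlinarith [sq_nonneg (C - 1), inv_pos.2 hC0]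
  constructor
  · nlinarith [norm_nonneg v]
  · have h3 : C⁻¹ * ‖v‖ ≤ ‖u‖ := by linarith
    calc ‖v‖ = C * (C⁻¹ * ‖v‖) := by rw [mul_inv_cancel_left₀ hC0.ne']
      _ ≤ _ := by gcongr

/-! ### Projecting a sphere to its tangent hyperplane -/

/-- Orthonormal coordinates on the hyperplane orthogonal to `X₀`; `q` serves as a chart of the
sphere near `X₀`. -/
theorem exists_isometry_orthogonal_projection {k : ℕ} (X₀ : Euc (k + 1)) (hX : X₀ ≠ 0) :
    ∃ (ι : Euc k →ₗᵢ[ℝ] Euc (k + 1)) (q : Euc (k + 1) →L[ℝ] Euc k),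
      (∀ v, ι (q v) = v - (⟪X₀, v⟫ / ‖X₀‖ ^ 2) • X₀) ∧ ∀ v, ‖q v‖ ≤ ‖v‖ := by
  have : Fact (Module.finrank ℝ (Euc (k + 1)) = k + 1) := ⟨by simp⟩
  let K := (Submodule.span ℝ {X₀})ᗮ
  have hK : Module.finrank ℝ K = k := Submodule.finrank_orthogonal_span_singleton hX
  let b : OrthonormalBasis (Fin k) ℝ K := (stdOrthonormalBasis ℝ K).reindex (finCongr hK)
  refine ⟨K.subtypeₗᵢ.comp b.repr.symm.toLinearIsometry,
    b.repr.toContinuousLinearEquiv.toContinuousLinearMap.comp K.orthogonalProjectionOnto,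
    fun v => ?_, fun v => ?_⟩
  · have h1 : (Submodule.span ℝ {X₀}).starProjection v = (⟪X₀, v⟫ / ‖X₀‖ ^ 2) • X₀ := by
      simpa using Submodule.starProjection_singleton ℝ (v := X₀) v
    have h2 := Submodule.starProjection_add_starProjection_orthogonal (K := Submodule.span ℝ {X₀}) v
    rw [h1] at h2
    simp
    rw [eq_sub_iff_add_eq']
    exact h2
  · simpa using K.norm_orthogonalProjectionOnto_apply_le v

/-- On a sphere, chords near `X₀` are almost orthogonal to `X₀`. -/
theorem isLittleO_inner_sub_sphere {E : Type*} [NormedAddCommGroup E] [InnerProductSpace ℝ E]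
    (X₀ : E) (R : ℝ) :
    (fun p : E × E => ⟪X₀, p.1 - p.2⟫)
      =o[𝓝[Metric.sphere (0 : E) R] X₀ ×ˢ 𝓝[Metric.sphere (0 : E) R] X₀]
        fun p => p.1 - p.2 := by
  have hlim : Tendsto (fun p : E × E => ‖X₀ - (1 / 2 : ℝ) • (p.1 + p.2)‖) (𝓝 X₀ ×ˢ 𝓝 X₀) (𝓝 0) := by
    rw [← nhds_prod_eq]
    have : Continuous fun p : E × E => ‖X₀ - (1 / 2 : ℝ) • (p.1 + p.2)‖ := by fun_prop
    convert this.tendsto (X₀, X₀)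
    simp [← two_smul ℝ X₀, smul_smul]
  replace hlim := hlim.mono_left (prod_mono nhdsWithin_le_nhds nhdsWithin_le_nhds :
    𝓝[Metric.sphere (0 : E) R] X₀ ×ˢ 𝓝[Metric.sphere (0 : E) R] X₀ ≤ _)
  have hmem : ∀ᶠ p : E × E in 𝓝[Metric.sphere (0 : E) R] X₀ ×ˢ 𝓝[Metric.sphere (0 : E) R] X₀,
      p.1 ∈ Metric.sphere (0 : E) R ∧ p.2 ∈ Metric.sphere (0 : E) R :=
    prod_mem_prod self_mem_nhdsWithin self_mem_nhdsWithin
  refine IsLittleO.of_bound fun c hc => ?_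
  filter_upwards [hmem, hlim.eventually (gt_mem_nhds hc)] with p hp hpc
  -- A chord is orthogonal to its midpoint, so `X₀` may be replaced by its difference from the
  -- midpoint, which tends to zero.
  have h0 : ⟪p.1 + p.2, p.1 - p.2⟫ = 0 := by
    rw [inner_add_left, inner_sub_right, inner_sub_right, real_inner_self_eq_norm_sq,
      real_inner_self_eq_norm_sq, mem_sphere_zero_iff_norm.1 hp.1, mem_sphere_zero_iff_norm.1 hp.2,
      real_inner_comm]
    ring
  have : ⟪X₀, p.1 - p.2⟫ = ⟪X₀ - (1 / 2 : ℝ) • (p.1 + p.2), p.1 - p.2⟫ := by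
    rw [inner_sub_left, inner_smul_left, h0]; simp
  rw [this]
  refine (norm_inner_le_norm _ _).trans ?_
  gcongr

/-- The volume factor of `(u, s) ↦ O u + s w`, with `O` an isometry, is the distance from `w` to
the range of `O`. -/
theorem normDet_isometry_coprod {k : ℕ} {F : Type*} [NormedAddCommGroup F] [InnerProductSpace ℝ F]
    [FiniteDimensional ℝ F] (O : Euc k →ₗᵢ[ℝ] F) (w : F) (c : Euc k) (y : F) (hw : w = O c + y)
    (hy : ∀ v, ⟪O v, y⟫ = 0) (L : WithLp 2 (Euc k × ℝ) →ₗ[ℝ] F)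
    (hL : ∀ h, L h = O h.fst + h.snd • w) : L.normDet = ‖y‖ := by
  rw [← sq_eq_sq₀ (LinearMap.normDet_nonneg _) (norm_nonneg _)]
  let b := (EuclideanSpace.basisFun (Fin k) ℝ).prod (OrthonormalBasis.singleton (Fin 1) ℝ)
  have := L.normDet_sq_eq_det_gram b
  simp only [RCLike.ofReal_real_eq_id, id_eq] at this
  rw [this]
  have hg : Matrix.gram ℝ (fun i => L (b i)) = Matrix.fromBlocks (1 : Matrix (Fin k) (Fin k) ℝ)
      (Matrix.of fun i _ => c i) (Matrix.of fun _ j => c j)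
      (Matrix.of fun (_ _ : Fin 1) => ‖c‖ ^ 2 + ‖y‖ ^ 2) := by
    have hO : ∀ i, ⟪O (EuclideanSpace.single i 1), w⟫ = c i := fun i => by
      rw [hw, inner_add_right, hy, O.inner_map_map]
      simp [EuclideanSpace.inner_single_left]
    have hww : ⟪w, w⟫ = ‖c‖ ^ 2 + ‖y‖ ^ 2 := by
      rw [hw, inner_add_left, inner_add_right, inner_add_right, hy, real_inner_comm (O c) y, hy,
        O.inner_map_map, real_inner_self_eq_norm_sq, real_inner_self_eq_norm_sq]
      ring
    ext (i | i) (j | j)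
    · simp [b, hL, Matrix.gram_apply, Matrix.one_apply, EuclideanSpace.inner_single_left]
    · simp [b, hL, Matrix.gram_apply, hO]
    · rw [Matrix.gram_apply, real_inner_comm]
      simp [b, hL, hO]
    · simp [b, hL, Matrix.gram_apply, hww, -inner_self_eq_norm_sq_to_K]
  -- The Schur complement of the identity block is `‖c‖² + ‖y‖² - ‖c‖²`: the shear `c` drops out.
  rw [hg, Matrix.det_fromBlocks_one₁₁]
  have hc := EuclideanSpace.real_norm_sq_eq c
  simp only [Matrix.det_unique, Matrix.sub_apply, Matrix.mul_apply, Matrix.of_apply]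
  rw [hc]
  simp [pow_two]

/-- The error is the component of the chord along `X₀`, negligible against the chord; therefore the
chord is itself controlled by its projection. -/
theorem isLittleO_sub_projection_sphere {k : ℕ} (R : ℝ) {X₀ : Euc (k + 1)}
    {ι : Euc k →ₗᵢ[ℝ] Euc (k + 1)}
    {q : Euc (k + 1) →L[ℝ] Euc k}
    (hq : ∀ v, ι (q v) = v - (⟪X₀, v⟫ / ‖X₀‖ ^ 2) • X₀) :
    (fun p : Euc (k + 1) × Euc (k + 1) => p.1 - p.2 - ι (q p.1 - q p.2))
      =o[𝓝[Metric.sphere 0 R] X₀ ×ˢ 𝓝[Metric.sphere 0 R] X₀] fun p => q p.1 - q p.2 := by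
  have h1 : (fun p : Euc (k + 1) × Euc (k + 1) => p.1 - p.2 - ι (q p.1 - q p.2))
      =o[𝓝[Metric.sphere 0 R] X₀ ×ˢ 𝓝[Metric.sphere 0 R] X₀] fun p => p.1 - p.2 := by
    have h2 : ∀ p : Euc (k + 1) × Euc (k + 1), p.1 - p.2 - ι (q p.1 - q p.2) =
        (⟪X₀, p.1 - p.2⟫ / ‖X₀‖ ^ 2) • X₀ := fun p => by
      rw [← map_sub, hq, sub_sub_cancel]
    simp_rw [h2, div_eq_inv_mul]
    refine IsBigO.trans_isLittleO (IsBigO.of_bound (‖X₀‖⁻¹ ^ 2 * ‖X₀‖)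
      (Eventually.of_forall fun p => ?_)) (isLittleO_inner_sub_sphere X₀ R)
    rw [norm_smul, norm_mul]
    simp only [norm_inv, norm_pow, norm_norm, inv_pow]
    exact le_of_eq (by ring)
  refine h1.trans_isBigO (h1.right_isBigO_sub.trans ?_)
  refine IsBigO.of_bound 1 (Eventually.of_forall fun p => ?_)
  simp [-map_sub]

theorem eventually_sphere_projection {k : ℕ} (R : ℝ) {X₀ : Euc (k + 1)}
    {ι : Euc k →ₗᵢ[ℝ] Euc (k + 1)}
    {q : Euc (k + 1) →L[ℝ] Euc k}
    (hq : ∀ v, ι (q v) = v - (⟪X₀, v⟫ / ‖X₀‖ ^ 2) • X₀) {C : ℝ} (hC : 1 < C) :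
    ∀ᶠ p : Euc (k + 1) × Euc (k + 1) in 𝓝[Metric.sphere 0 R] X₀ ×ˢ 𝓝[Metric.sphere 0 R] X₀,
      ‖p.1 - p.2‖ ≤ C * ‖q p.1 - q p.2‖ := by
  have := eventually_norm_sub_le_of_isLittleO (T := ι.toContinuousLinearMap) (g := id) (h := q)
    ι.injective (isLittleO_sub_projection_sphere R hq) hC
  filter_upwards [this] with p hp
  simpa [-map_sub] using hp.1

/-- By compactness it suffices to argue locally, where the sphere is a Lipschitz image of a bounded
subset of `ℝᵏ`. -/
theorem euclideanHausdorffMeasure_sphere_lt_top {k : ℕ} {R : ℝ} (hR : 0 < R) :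
    μHE[k] (Metric.sphere (0 : Euc (k + 1)) R) < ⊤ := by
  refine (isCompact_sphere _ _).measure_lt_top_of_nhdsWithin fun X₀ hX₀ => ?_
  have hne : X₀ ≠ 0 := Metric.ne_of_mem_sphere hX₀ hR.ne'
  obtain ⟨ι, q, hq, hq1⟩ := exists_isometry_orthogonal_projection X₀ hne
  have hev := eventually_sphere_projection R hq one_lt_two
  obtain ⟨N, hN, hNp⟩ := mem_prod_self_iff.1 hev
  refine ⟨N ∩ Metric.closedBall 0 R, inter_mem hN ?_, ?_⟩
  · exact mem_of_superset self_mem_nhdsWithin Metric.sphere_subset_closedBall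
  have h1 := euclideanHausdorffMeasure_image_le_of_dist_le id q (N ∩ Metric.closedBall 0 R) 2 k
    fun z hz z' hz' => by
      have := hNp (mk_mem_prod hz.1 hz'.1)
      simpa [dist_eq_norm] using this
  rw [image_id, EuclideanSpace.euclideanHausdorffMeasure_eq_volume] at h1
  refine h1.trans_lt (ENNReal.mul_lt_top (by simp) ?_)
  refine Bornology.IsBounded.measure_lt_top ?_
  refine (Metric.isBounded_closedBall (x := (0 : Euc k)) (r := R)).subset ?_
  rintro _ ⟨z, hz, rfl⟩
  have := hz.2
  simp only [mem_closedBall_zero_iff] at this ⊢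
  exact (hq1 z).trans this

/-! ### The product measure in projected coordinates -/

/-- The product of the `k`-dimensional volume on a sphere of `ℝᵏ⁺¹` and the Lebesgue measure. -/
noncomputable def sphereProdMeasure (k : ℕ) (R : ℝ) : Measure (Euc (k + 1) × ℝ) :=
  ((μHE[k] : Measure (Euc (k + 1))).restrict (Metric.sphere 0 R)).prod volume

theorem volume_image_toLp_prod {Z : Type*} {k : ℕ} (u : Z → Euc k) (v : Z → ℝ) {A : Set Z}
    (hA : MeasurableSet ((fun z => (u z, v z)) '' A)) :
    volume ((fun z => WithLp.toLp 2 (u z, v z)) '' A) = volume ((fun z => (u z, v z)) '' A) := by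
  rw [← (WithLp.volume_preserving_ofLp (Euc k) ℝ).measure_preimage hA.nullMeasurableSet]
  congr 1
  ext h
  constructor
  · rintro ⟨z, hz, rfl⟩
    exact ⟨z, hz, rfl⟩
  · rintro ⟨z, hz, h'⟩
    exact ⟨z, hz, congrArg (WithLp.toLp 2) h'⟩

theorem slice_image_prodMap {X Y : Type*} (q : X → Y) (A : Set (X × ℝ)) (t : ℝ) :
    (fun y => (y, t)) ⁻¹' ((fun z : X × ℝ => (q z.1, z.2)) '' A) =
      q '' ((fun x => (x, t)) ⁻¹' A) := by
  ext v
  constructor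
  · rintro ⟨⟨x, s⟩, hz, h⟩
    obtain ⟨h1, h2⟩ := Prod.mk.inj h
    subst h2
    exact ⟨x, hz, h1⟩
  · rintro ⟨x, hx, rfl⟩
    exact ⟨(x, t), hx, rfl⟩

/-- Fubini reduces the claim to slices of constant `t`, on which `q` is 1-Lipschitz with
`C`-Lipschitz inverse. -/
theorem volume_image_projection_comparison {k : ℕ} {R : ℝ} (hR : 0 < R)
    {q : Euc (k + 1) →L[ℝ] Euc k} (hq1 : ∀ v, ‖q v‖ ≤ ‖v‖) {C : ℝ≥0} {A : Set (Euc (k + 1) × ℝ)}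
    (hA : MeasurableSet A) (hAS : ∀ z ∈ A, z.1 ∈ Metric.sphere (0 : Euc (k + 1)) R)
    (hAC : ∀ z ∈ A, ∀ z' ∈ A, ‖z.1 - z'.1‖ ≤ C * ‖q z.1 - q z'.1‖) :
    volume ((fun z : Euc (k + 1) × ℝ => WithLp.toLp 2 (q z.1, z.2)) '' A) ≤
        sphereProdMeasure k R A ∧
      sphereProdMeasure k R A ≤
        C ^ k * volume ((fun z : Euc (k + 1) × ℝ => WithLp.toLp 2 (q z.1, z.2)) '' A) := by
  have : IsFiniteMeasure ((μHE[k] : Measure (Euc (k + 1))).restrict (Metric.sphere 0 R)) :=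
    ⟨by simpa using euclideanHausdorffMeasure_sphere_lt_top hR⟩
  let Q : Euc (k + 1) × ℝ → Euc k × ℝ := fun z => (q z.1, z.2)
  have hQc : Continuous Q := by fun_prop
  have hQinj : InjOn Q A := by
    intro z hz z' hz' h
    have h1 := hAC z hz z' hz'
    rw [show q z.1 = q z'.1 from (Prod.ext_iff.1 h).1, sub_self, norm_zero, mul_zero] at h1
    exact Prod.ext (sub_eq_zero.1 (norm_le_zero_iff.1 h1)) (Prod.ext_iff.1 h).2
  -- Lusin–Souslin: an injective continuous image of a Borel set is Borel.
  have hQA : MeasurableSet (Q '' A) := hA.image_of_continuousOn_injOn hQc.continuousOn hQinj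
  have hvol : volume ((fun z : Euc (k + 1) × ℝ => WithLp.toLp 2 (q z.1, z.2)) '' A) =
      volume (Q '' A) := volume_image_toLp_prod _ _ hQA
  rw [hvol, Measure.volume_eq_prod, Measure.prod_apply_symm hQA, sphereProdMeasure,
    Measure.prod_apply_symm hA]
  have hslice : ∀ t : ℝ, (fun x => (x, t)) ⁻¹' (Q '' A) = q '' ((fun x => (x, t)) ⁻¹' A) :=
    slice_image_prodMap q A
  have hsub : ∀ t : ℝ, (fun x => (x, t)) ⁻¹' A ⊆ Metric.sphere (0 : Euc (k + 1)) R :=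
    fun t x hx => hAS (x, t) hx
  simp_rw [hslice, fun t => Measure.restrict_eq_self μHE[k] (hsub t),
    ← EuclideanSpace.euclideanHausdorffMeasure_eq_volume]
  constructor
  · refine lintegral_mono fun t => ?_
    have := euclideanHausdorffMeasure_image_le_of_dist_le q id ((fun x => (x, t)) ⁻¹' A) 1 k
      fun z _ z' _ => by simpa [dist_eq_norm, ← map_sub] using hq1 (z - z')
    simpa using this
  · rw [← lintegral_const_mul' _ _ (by simp)]
    refine lintegral_mono fun t => ?_
    have := euclideanHausdorffMeasure_image_le_of_dist_le id q ((fun x => (x, t)) ⁻¹' A) C k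
      fun z hz z' hz' => by simpa [dist_eq_norm] using hAC (z, t) hz (z', t) hz'
    simpa using this

/-- A countable subcover is made disjoint and summed. The local bound must hold for all measurable
subsets of `U`, since the disjoint pieces are only parts of the neighbourhoods. -/
theorem measure_le_of_locally_le {X : Type*} [TopologicalSpace X] [SecondCountableTopology X]
    [MeasurableSpace X] [OpensMeasurableSpace X] {ρ σ : Measure X} {D : Set X}
    (hD : MeasurableSet D) {K : ℝ≥0∞}
    (h : ∀ x ∈ D, ∃ U ∈ 𝓝[D] x, ∀ A ⊆ U, A ⊆ D → MeasurableSet A → ρ A ≤ K * σ A) :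
    ρ D ≤ K * σ D := by
  choose! U hU hUA using h
  have hV : ∀ x ∈ D, ∃ V, IsOpen V ∧ x ∈ V ∧ V ∩ D ⊆ U x := fun x hx =>
    mem_nhdsWithin.1 (hU x hx)
  choose! V hVo hxV hVU using hV
  obtain ⟨t, htD, htc, ht⟩ := TopologicalSpace.countable_cover_nhdsWithin
    (s := D) (f := V) fun x hx => mem_nhdsWithin_of_mem_nhds ((hVo x hx).mem_nhds (hxV x hx))
  rcases t.eq_empty_or_nonempty with rfl | hne
  · have : D = ∅ := by simpa using ht
    simp [this]
  obtain ⟨e, rfl⟩ := htc.exists_eq_range hne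
  have heD : ∀ i, e i ∈ D := fun i => htD ⟨i, rfl⟩
  let B : ℕ → Set X := fun i => V (e i) ∩ D
  have hBm : ∀ i, MeasurableSet (B i) := fun i => (hVo _ (heD i)).measurableSet.inter hD
  have hDB : D = ⋃ i, disjointed B i := by
    rw [iUnion_disjointed]
    ext x
    refine ⟨fun hx => ?_, fun hx => ?_⟩
    · obtain ⟨y, ⟨i, rfl⟩, hy⟩ := mem_iUnion₂.1 (ht hx)
      exact mem_iUnion.2 ⟨i, hy, hx⟩
    · obtain ⟨i, hi⟩ := mem_iUnion.1 hx
      exact hi.2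
  have hm : ∀ i, MeasurableSet (disjointed B i) := MeasurableSet.disjointed hBm
  rw [hDB, measure_iUnion (disjoint_disjointed B) hm, measure_iUnion (disjoint_disjointed B) hm,
    ← ENNReal.tsum_mul_left]
  refine ENNReal.tsum_le_tsum fun i => ?_
  have hsub := disjointed_subset B i
  exact hUA (e i) (heD i) _ (hsub.trans (hVU _ (heD i))) (hsub.trans inter_subset_right) (hm i)

/-! ### The area formula on sphere times interval -/

/-- The linear map `(u, s) ↦ O u + s w`. -/
noncomputable def isometryCoprod {k : ℕ} {F : Type*} [NormedAddCommGroup F]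
    [InnerProductSpace ℝ F] (O : Euc k →ₗᵢ[ℝ] F) (w : F) : WithLp 2 (Euc k × ℝ) →L[ℝ] F :=
  O.toContinuousLinearMap.comp (WithLp.fstL 2 ℝ (Euc k) ℝ) +
    (WithLp.sndL 2 ℝ (Euc k) ℝ).smulRight w

theorem isometryCoprod_apply {k : ℕ} {F : Type*} [NormedAddCommGroup F]
    [InnerProductSpace ℝ F] (O : Euc k →ₗᵢ[ℝ] F) (w : F) (h : WithLp 2 (Euc k × ℝ)) :
    isometryCoprod O w h = O h.fst + h.snd • w := rfl

/-- Two errors add up: that of strict differentiability, and `W` applied to the defect of the chord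
from its projection. Both are negligible because on the sphere the full increment is bounded by the
projected one (`hZ`). -/
theorem isLittleO_sub_isometryCoprod {k : ℕ} {F : Type*} [NormedAddCommGroup F]
    [InnerProductSpace ℝ F] {G : Euc (k + 1) × ℝ → F} {R : ℝ} {U : Set ℝ} {z₀ : Euc (k + 1) × ℝ}
    (W : Euc (k + 1) →ₗᵢ[ℝ] F) (w : F)
    (hG : HasStrictFDerivAt G (W.toContinuousLinearMap.comp (.fst ℝ _ _) +
      (ContinuousLinearMap.snd ℝ (Euc (k + 1)) ℝ).smulRight w) z₀)
    {ι : Euc k →ₗᵢ[ℝ] Euc (k + 1)} {q : Euc (k + 1) →L[ℝ] Euc k}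
    (hq : ∀ v, ι (q v) = v - (⟪z₀.1, v⟫ / ‖z₀.1‖ ^ 2) • z₀.1) :
    (fun p : (Euc (k + 1) × ℝ) × (Euc (k + 1) × ℝ) => G p.1 - G p.2 -
      isometryCoprod (W.comp ι) w
        (WithLp.toLp 2 (q p.1.1, p.1.2) - WithLp.toLp 2 (q p.2.1, p.2.2)))
      =o[𝓝[Metric.sphere 0 R ×ˢ U] z₀ ×ˢ 𝓝[Metric.sphere 0 R ×ˢ U] z₀]
        fun p => WithLp.toLp 2 (q p.1.1, p.1.2) - WithLp.toLp 2 (q p.2.1, p.2.2) := by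
  set l := 𝓝[Metric.sphere 0 R ×ˢ U] z₀ ×ˢ 𝓝[Metric.sphere 0 R ×ˢ U] z₀
  have hfst : Tendsto (fun p : (Euc (k + 1) × ℝ) × (Euc (k + 1) × ℝ) => (p.1.1, p.2.1)) l
      (𝓝[Metric.sphere 0 R] z₀.1 ×ˢ 𝓝[Metric.sphere 0 R] z₀.1) := by
    have : Tendsto Prod.fst (𝓝[Metric.sphere 0 R ×ˢ U] z₀) (𝓝[Metric.sphere 0 R] z₀.1) := by
      rw [← Prod.mk.eta (p := z₀), nhdsWithin_prod_eq]
      exact tendsto_fst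
    exact this.prodMap this
  have hs := (isLittleO_sub_projection_sphere R hq).comp_tendsto hfst
  have hle : (fun p : (Euc (k + 1) × ℝ) × (Euc (k + 1) × ℝ) => q p.1.1 - q p.2.1) =O[l]
      fun p => WithLp.toLp 2 (q p.1.1, p.1.2) - WithLp.toLp 2 (q p.2.1, p.2.2) :=
    IsBigO.of_bound 1 (Eventually.of_forall fun p => by
      simpa using WithLp.norm_fst_le (p := 2) _
        (WithLp.toLp 2 (q p.1.1, p.1.2) - WithLp.toLp 2 (q p.2.1, p.2.2)))
  have hle2 : (fun p : (Euc (k + 1) × ℝ) × (Euc (k + 1) × ℝ) => p.1.2 - p.2.2) =O[l]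
      fun p => WithLp.toLp 2 (q p.1.1, p.1.2) - WithLp.toLp 2 (q p.2.1, p.2.2) :=
    IsBigO.of_bound 1 (Eventually.of_forall fun p => by
      simpa using WithLp.norm_snd_le (p := 2) _
        (WithLp.toLp 2 (q p.1.1, p.1.2) - WithLp.toLp 2 (q p.2.1, p.2.2)))
  have hs' := hs.trans_isBigO hle
  have hX : (fun p : (Euc (k + 1) × ℝ) × (Euc (k + 1) × ℝ) => p.1.1 - p.2.1) =O[l]
      fun p => WithLp.toLp 2 (q p.1.1, p.1.2) - WithLp.toLp 2 (q p.2.1, p.2.2) := by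
    have h1 : (fun p : (Euc (k + 1) × ℝ) × (Euc (k + 1) × ℝ) => ι (q p.1.1 - q p.2.1)) =O[l]
        fun p => WithLp.toLp 2 (q p.1.1, p.1.2) - WithLp.toLp 2 (q p.2.1, p.2.2) :=
      (IsBigO.of_bound 1 (Eventually.of_forall fun p => by simp [-map_sub])).trans hle
    simpa [Function.comp_def] using hs'.isBigO.add h1
  have hZ : (fun p : (Euc (k + 1) × ℝ) × (Euc (k + 1) × ℝ) => p.1 - p.2) =O[l]
      fun p => WithLp.toLp 2 (q p.1.1, p.1.2) - WithLp.toLp 2 (q p.2.1, p.2.2) :=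
    hX.prod_left hle2
  have hG1 := (hG.isLittleO.mono (show l ≤ 𝓝 (z₀, z₀) by
    rw [nhds_prod_eq]; exact prod_mono nhdsWithin_le_nhds nhdsWithin_le_nhds)).trans_isBigO hZ
  have hW : (fun p : (Euc (k + 1) × ℝ) × (Euc (k + 1) × ℝ) =>
      W (p.1.1 - p.2.1 - ι (q p.1.1 - q p.2.1))) =o[l]
      fun p => WithLp.toLp 2 (q p.1.1, p.1.2) - WithLp.toLp 2 (q p.2.1, p.2.2) :=
    (IsBigO.of_bound 1 (Eventually.of_forall fun p => by
      simp only [LinearIsometry.norm_map, one_mul]; exact le_rfl)).trans_isLittleO hs'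
  refine (hG1.add hW).congr_left fun p => ?_
  simp [isometryCoprod_apply]
  abel

/-- Local comparison of the volume of the image of a tube with its expected value. -/
theorem local_volume_comparison {k : ℕ} {F : Type*} [NormedAddCommGroup F]
    [InnerProductSpace ℝ F] [FiniteDimensional ℝ F] [MeasurableSpace F] [BorelSpace F]
    {G : Euc (k + 1) × ℝ → F} {R : ℝ} (hR : 0 < R) {U : Set ℝ} {lam : Euc (k + 1) × ℝ → ℝ}
    {z₀ : Euc (k + 1) × ℝ} (hz₀ : z₀ ∈ Metric.sphere (0 : Euc (k + 1)) R ×ˢ U)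
    (W : Euc (k + 1) →ₗᵢ[ℝ] F) (w : F) (c : Euc (k + 1)) (y : F)
    (hG : HasStrictFDerivAt G (W.toContinuousLinearMap.comp (.fst ℝ _ _) +
      (ContinuousLinearMap.snd ℝ (Euc (k + 1)) ℝ).smulRight w) z₀)
    (hw : w = W c + y) (hc : ⟪z₀.1, c⟫ = 0) (hy : ∀ v, ⟪W v, y⟫ = 0) (hlam : lam z₀ = ‖y‖)
    (hpos : 0 < lam z₀) (hcont : ContinuousWithinAt lam (Metric.sphere 0 R ×ˢ U) z₀)
    {C : ℝ≥0} (hC : 1 < C) :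
    ∃ N ∈ 𝓝[Metric.sphere 0 R ×ˢ U] z₀, ∀ A ⊆ N, A ⊆ Metric.sphere 0 R ×ˢ U → MeasurableSet A →
      μHE[k + 1] (G '' A) ≤
          C ^ (k + 1) * C * ∫⁻ z in A, ENNReal.ofReal (lam z) ∂sphereProdMeasure k R ∧
        ∫⁻ z in A, ENNReal.ofReal (lam z) ∂sphereProdMeasure k R ≤
          C * C ^ k * C ^ (k + 1) * μHE[k + 1] (G '' A) := by
  have hX0 : z₀.1 ≠ 0 := Metric.ne_of_mem_sphere hz₀.1 hR.ne'
  obtain ⟨ι, q, hq, hq1⟩ := exists_isometry_orthogonal_projection z₀.1 hX0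
  set L := isometryCoprod (W.comp ι) w with hL
  let P : Euc (k + 1) × ℝ → WithLp 2 (Euc k × ℝ) := fun z => WithLp.toLp 2 (q z.1, z.2)
  have hdet : L.toLinearMap.normDet = lam z₀ := by
    rw [hlam]
    -- As `c` is orthogonal to `X₀`, `ι (q c) = c`; so `W c` lies in the range of `W ∘ ι`.
    refine normDet_isometry_coprod (W.comp ι) w (q c) y ?_ (fun v => hy _) _ fun h => rfl
    simp [hw, hq, hc]
  have hLinj : Function.Injective L := by
    have := LinearMap.normDet_eq_zero_iff_ker_ne_bot.not.1 (hdet.trans_ne hpos.ne')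
    exact LinearMap.ker_eq_bot.1 (not_not.1 this)
  have hC' : (1 : ℝ) < C := by exact_mod_cast hC
  have hev1 : ∀ᶠ p in 𝓝[Metric.sphere 0 R ×ˢ U] z₀ ×ˢ 𝓝[Metric.sphere 0 R ×ˢ U] z₀,
      ‖G p.1 - G p.2‖ ≤ C * ‖L (P p.1 - P p.2)‖ ∧ ‖L (P p.1 - P p.2)‖ ≤ C * ‖G p.1 - G p.2‖ :=
    eventually_norm_sub_le_of_isLittleO (g := G) (h := P) hLinj
      (isLittleO_sub_isometryCoprod (R := R) (U := U) W w hG hq) hC'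
  obtain ⟨N₁, hN₁, hN₁p⟩ := mem_prod_self_iff.1 hev1
  obtain ⟨N₂, hN₂, hN₂p⟩ := mem_prod_self_iff.1 (eventually_sphere_projection R hq hC')
  have hfst : Tendsto Prod.fst (𝓝[Metric.sphere 0 R ×ˢ U] z₀) (𝓝[Metric.sphere 0 R] z₀.1) := by
    rw [← Prod.mk.eta (p := z₀), nhdsWithin_prod_eq]
    exact tendsto_fst
  have hC0 : (0 : ℝ) < C := one_pos.trans hC'
  have hev3 : ∀ᶠ z in 𝓝[Metric.sphere 0 R ×ˢ U] z₀, lam z < C * lam z₀ :=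
    hcont.eventually (gt_mem_nhds (by nlinarith))
  have hev4 : ∀ᶠ z in 𝓝[Metric.sphere 0 R ×ˢ U] z₀, (C : ℝ)⁻¹ * lam z₀ < lam z :=
    hcont.eventually (lt_mem_nhds (by
      have := inv_lt_one_of_one_lt₀ hC'
      nlinarith))
  refine ⟨N₁ ∩ (Prod.fst ⁻¹' N₂ ∩ ({z | lam z < C * lam z₀} ∩ {z | (C : ℝ)⁻¹ * lam z₀ < lam z})),
    inter_mem hN₁ (inter_mem (hfst hN₂) (inter_mem hev3 hev4)), fun A hAN hAD hA => ?_⟩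
  have hG1 := euclideanHausdorffMeasure_image_le_of_dist_le G (fun z => L (P z)) A C (k + 1)
    fun z hz z' hz' => by
      have := (hN₁p (mk_mem_prod (hAN hz).1 (hAN hz').1)).1
      simpa [dist_eq_norm, ← map_sub] using this
  have hG2 := euclideanHausdorffMeasure_image_le_of_dist_le (fun z => L (P z)) G A C (k + 1)
    fun z hz z' hz' => by
      have := (hN₁p (mk_mem_prod (hAN hz).1 (hAN hz').1)).2
      simpa [dist_eq_norm, ← map_sub] using this
  have hLP : μHE[k + 1] ((fun z => L (P z)) '' A) = ENNReal.ofReal (lam z₀) * volume (P '' A) := by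
    have hfin : Module.finrank ℝ (WithLp 2 (Euc k × ℝ)) = k + 1 := by
      simp [(WithLp.linearEquiv 2 ℝ (Euc k × ℝ)).finrank_eq]
    have := L.toLinearMap.euclideanHausdorffMeasure_image_eq_normDet_mul_volume (P '' A)
    rw [hfin, hdet, image_image] at this
    exact this
  have hAS : ∀ z ∈ A, z.1 ∈ Metric.sphere (0 : Euc (k + 1)) R := by
    intro z hz
    have := hAD hz
    rw [mem_prod] at this
    exact this.1
  have hAC : ∀ z ∈ A, ∀ z' ∈ A, ‖z.1 - z'.1‖ ≤ C * ‖q z.1 - q z'.1‖ := by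
    intro z hz z' hz'
    have h1 : z.1 ∈ N₂ := (hAN hz).2.1
    have h2 : z'.1 ∈ N₂ := (hAN hz').2.1
    simpa only [mem_ofPred_eq] using hN₂p (mk_mem_prod h1 h2)
  have hv : volume (P '' A) ≤ sphereProdMeasure k R A ∧
      sphereProdMeasure k R A ≤ C ^ k * volume (P '' A) :=
    volume_image_projection_comparison hR hq1 hA hAS hAC
  obtain ⟨hv1, hv2⟩ := hv
  have hup : ∫⁻ z in A, ENNReal.ofReal (lam z) ∂sphereProdMeasure k R ≤
      C * (ENNReal.ofReal (lam z₀) * sphereProdMeasure k R A) := by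
    rw [← mul_assoc, ← setLIntegral_const]
    refine setLIntegral_mono' hA fun z hz => ?_
    rw [← ENNReal.ofReal_coe_nnreal, ← ENNReal.ofReal_mul hC0.le]
    exact ENNReal.ofReal_le_ofReal (hAN hz).2.2.1.le
  have hlow : ENNReal.ofReal (lam z₀) * sphereProdMeasure k R A ≤
      C * ∫⁻ z in A, ENNReal.ofReal (lam z) ∂sphereProdMeasure k R := by
    rw [← lintegral_const_mul' _ _ ENNReal.coe_ne_top, ← setLIntegral_const]
    refine setLIntegral_mono' hA fun z hz => ?_
    rw [← ENNReal.ofReal_coe_nnreal, ← ENNReal.ofReal_mul hC0.le]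
    refine ENNReal.ofReal_le_ofReal ?_
    have := (hAN hz).2.2.2
    rw [mem_ofPred_eq, inv_mul_lt_iff₀ hC0] at this
    exact this.le
  rw [hLP] at hG1 hG2
  -- Powers of `C`: `k + 1` for passing between `G` and its linear model, one for freezing `lam`,
  -- and `k` for undoing the projection. The last is absent from the upper bound, projections being
  -- 1-Lipschitz.
  constructor
  · calc μHE[k + 1] (G '' A) ≤ C ^ (k + 1) * (ENNReal.ofReal (lam z₀) * volume (P '' A)) := hG1
      _ ≤ C ^ (k + 1) * (ENNReal.ofReal (lam z₀) * sphereProdMeasure k R A) := by gcongr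
      _ ≤ C ^ (k + 1) * (C * ∫⁻ z in A, ENNReal.ofReal (lam z) ∂sphereProdMeasure k R) := by gcongr
      _ = _ := by ring
  · calc _ ≤ C * (ENNReal.ofReal (lam z₀) * sphereProdMeasure k R A) := hup
      _ ≤ C * (ENNReal.ofReal (lam z₀) * (C ^ k * volume (P '' A))) := by gcongr
      _ = C * C ^ k * (ENNReal.ofReal (lam z₀) * volume (P '' A)) := by ring
      _ ≤ C * C ^ k * (C ^ (k + 1) * μHE[k + 1] (G '' A)) := by gcongr
      _ = _ := by ring

theorem le_of_forall_one_lt_pow_mul {x y : ℝ≥0∞} (m : ℕ)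
    (h : ∀ C : ℝ≥0, 1 < C → x ≤ (C : ℝ≥0∞) ^ m * y) : x ≤ y := by
  have hlim : Tendsto (fun C : ℝ≥0 => (C : ℝ≥0∞) ^ m * y) (𝓝[>] 1) (𝓝 (1 * y)) := by
    -- The limit factor 1 is nonzero, so `y = ∞` is allowed.
    refine ENNReal.Tendsto.mul_const ?_ (Or.inl one_ne_zero)
    have : Continuous fun C : ℝ≥0 => ((C ^ m : ℝ≥0) : ℝ≥0∞) := by fun_prop
    simpa using (this.tendsto 1).mono_left nhdsWithin_le_nhds
  rw [one_mul] at hlim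
  exact ge_of_tendsto hlim (eventually_nhdsWithin_of_forall fun C hC => h C hC)

/-- The area formula for a tube around a curve. -/
theorem volume_image_sphere_prod {k : ℕ} {F : Type*} [NormedAddCommGroup F]
    [InnerProductSpace ℝ F] [FiniteDimensional ℝ F] [MeasurableSpace F] [BorelSpace F]
    {G : Euc (k + 1) × ℝ → F} {R : ℝ} (hR : 0 < R) {U : Set ℝ} (hU : MeasurableSet U)
    {lam : Euc (k + 1) × ℝ → ℝ}
    (hinj : InjOn G (Metric.sphere 0 R ×ˢ U)) (hcont : ContinuousOn G (Metric.sphere 0 R ×ˢ U))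
    (hlam : ContinuousOn lam (Metric.sphere 0 R ×ˢ U))
    (hpos : ∀ z ∈ Metric.sphere (0 : Euc (k + 1)) R ×ˢ U, 0 < lam z)
    (h : ∀ z ∈ Metric.sphere (0 : Euc (k + 1)) R ×ˢ U,
      ∃ (W : Euc (k + 1) →ₗᵢ[ℝ] F) (c : Euc (k + 1)) (y : F),
        HasStrictFDerivAt G (W.toContinuousLinearMap.comp (.fst ℝ _ _) +
          (ContinuousLinearMap.snd ℝ (Euc (k + 1)) ℝ).smulRight (W c + y)) z ∧
        ⟪z.1, c⟫ = 0 ∧ (∀ v, ⟪W v, y⟫ = 0) ∧ lam z = ‖y‖) :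
    μHE[k + 1] (G '' (Metric.sphere 0 R ×ˢ U)) =
      ∫⁻ z in Metric.sphere 0 R ×ˢ U, ENNReal.ofReal (lam z) ∂sphereProdMeasure k R := by
  set D : Set (Euc (k + 1) × ℝ) := Metric.sphere 0 R ×ˢ U with hDdef
  have hD : MeasurableSet D := Metric.isClosed_sphere.measurableSet.prod hU
  have hemb : MeasurableEmbedding (D.domRestrict G) := hcont.measurableEmbedding hD hinj
  -- Injectivity makes the volume of the image a measure on the source, so that local comparison
  -- applies to it.
  let ρ : Measure (Euc (k + 1) × ℝ) := ((μHE[k + 1]).comap (D.domRestrict G)).map Subtype.val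
  have hρ : ∀ A ⊆ D, MeasurableSet A → ρ A = μHE[k + 1] (G '' A) := by
    intro A hAD hA
    rw [Measure.map_apply measurable_subtype_coe hA, hemb.comap_apply]
    congr 1
    rw [domRestrict_eq, image_comp, Subtype.image_preimage_coe, inter_eq_right.2 hAD]
  let σ : Measure (Euc (k + 1) × ℝ) :=
    (sphereProdMeasure k R).withDensity fun z => ENNReal.ofReal (lam z)
  have hσ : ∀ A, MeasurableSet A → σ A =
      ∫⁻ z in A, ENNReal.ofReal (lam z) ∂sphereProdMeasure k R := fun A hA =>
    withDensity_apply _ hA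
  rw [← hρ D subset_rfl hD, ← hσ D hD]
  apply le_antisymm
  · refine le_of_forall_one_lt_pow_mul (k + 2) fun C hC => measure_le_of_locally_le hD fun z hz => ?_
    obtain ⟨W, c, y, hG, hc, hy, hl⟩ := h z hz
    obtain ⟨N, hN, hNA⟩ := local_volume_comparison hR hz W _ c y hG rfl hc hy hl (hpos z hz)
      (hlam z hz) hC
    refine ⟨N, hN, fun A hAN hAD hA => ?_⟩
    rw [hρ A hAD hA, hσ A hA, pow_succ]
    exact (hNA A hAN hAD hA).1
  · refine le_of_forall_one_lt_pow_mul (1 + k + (k + 1)) fun C hC =>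
      measure_le_of_locally_le hD fun z hz => ?_
    obtain ⟨W, c, y, hG, hc, hy, hl⟩ := h z hz
    obtain ⟨N, hN, hNA⟩ := local_volume_comparison hR hz W _ c y hG rfl hc hy hl (hpos z hz)
      (hlam z hz) hC
    refine ⟨N, hN, fun A hAN hAD hA => ?_⟩
    rw [hρ A hAD hA, hσ A hA, pow_add, pow_add, pow_one]
    exact (hNA A hAN hAD hA).2

/-! ### `C¹` regularity of the Frenet frame -/

theorem contDiffOn_iteratedDerivWithin {E : Type*} [NormedAddCommGroup E] [NormedSpace ℝ E]
    {s : Set ℝ} (hs : UniqueDiffOn ℝ s) {f : ℝ → E} (i r : ℕ)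
    (hf : ContDiffOn ℝ ((r + i : ℕ) : ℕ∞ω) f s) :
    ContDiffOn ℝ r (iteratedDerivWithin i f s) s := by
  induction i generalizing r with
  | zero => simpa using hf
  | succ i ih =>
    rw [iteratedDerivWithin_succ]
    refine (ih (r + 1) ?_).derivWithin hs (by norm_cast)
    rwa [show r + 1 + i = r + (i + 1) by omega]

theorem contDiffOn_gramSchmidt {E : Type*} [NormedAddCommGroup E] [InnerProductSpace ℝ E] {m : ℕ}
    {s : Set ℝ} {u : Fin m → ℝ → E} (hu : ∀ i, ContDiffOn ℝ 1 (u i) s)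
    (hli : ∀ t ∈ s, LinearIndependent ℝ fun i => u i t) (i : Fin m) :
    ContDiffOn ℝ 1 (fun t => InnerProductSpace.gramSchmidt ℝ (fun k => u k t) i) s := by
  induction i using WellFoundedLT.induction with
  | ind i ih =>
    refine ContDiffOn.congr (f := fun t => u i t - ∑ j ∈ Finset.Iio i,
      (⟪InnerProductSpace.gramSchmidt ℝ (fun k => u k t) j, u i t⟫ /
        ‖InnerProductSpace.gramSchmidt ℝ (fun k => u k t) j‖ ^ 2) •
          InnerProductSpace.gramSchmidt ℝ (fun k => u k t) j) ?_ fun t _ => by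
      rw [InnerProductSpace.gramSchmidt_def]
      simp_rw [Submodule.starProjection_singleton]
      rfl
    refine (hu i).sub (ContDiffOn.sum fun j hj => ?_)
    have hj' := ih j (Finset.mem_Iio.1 hj)
    refine ContDiffOn.smul (ContDiffOn.div (hj'.inner ℝ (hu i)) ?_ fun t ht => ?_) hj'
    · exact hj'.norm_sq ℝ
    · have := InnerProductSpace.gramSchmidt_ne_zero j (hli t ht)
      simpa using this

theorem contDiffOn_gramSchmidtNormed {E : Type*} [NormedAddCommGroup E] [InnerProductSpace ℝ E]
    {m : ℕ} {s : Set ℝ} {u : Fin m → ℝ → E} (hu : ∀ i, ContDiffOn ℝ 1 (u i) s)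
    (hli : ∀ t ∈ s, LinearIndependent ℝ fun i => u i t) (i : Fin m) :
    ContDiffOn ℝ 1 (fun t => InnerProductSpace.gramSchmidtNormed ℝ (fun k => u k t) i) s := by
  have h := contDiffOn_gramSchmidt hu hli i
  have hne : ∀ t ∈ s, InnerProductSpace.gramSchmidt ℝ (fun k => u k t) i ≠ 0 := fun t ht =>
    InnerProductSpace.gramSchmidt_ne_zero i (hli t ht)
  exact ((h.norm ℝ hne).inv fun t ht => norm_ne_zero_iff.2 (hne t ht)).smul h

theorem exists_orthonormalBasis_of_orthonormal {d : ℕ} {v : Fin d → Euc d}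
    (hv : Orthonormal ℝ v) : ∃ b : OrthonormalBasis (Fin d) ℝ (Euc d), ∀ i, b i = v i := by
  refine ⟨OrthonormalBasis.mk hv ?_, fun i => by rw [OrthonormalBasis.coe_mk]⟩
  rw [hv.linearIndependent.span_eq_top_of_card_eq_finrank' (by simp)]

/-- The component along `V m` of a vector, computed from the other members of the frame. -/
theorem smul_eq_sub_sum_of_orthonormal {d : ℕ} {v : Fin d → Euc d} (hv : Orthonormal ℝ v)
    (m : Fin d) (x : Euc d) :
    ⟪v m, x⟫ • v m = x - ∑ j ∈ Finset.univ.erase m, ⟪v j, x⟫ • v j := by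
  obtain ⟨b, hb⟩ := exists_orthonormalBasis_of_orthonormal hv
  have := b.sum_repr' x
  simp only [hb] at this
  rw [eq_sub_iff_add_eq,
    Finset.add_sum_erase _ (fun j => ⟪v j, x⟫ • v j) (Finset.mem_univ m), this]

/-- Removing from the fixed vector `V m t₀` its components along the other frame members leaves a
`C¹` multiple of `V m t`. Positivity of the factor makes its normalisation `V m t`, not `-V m t`. -/
theorem contDiffWithinAt_of_orthonormal {d : ℕ} {V : Fin d → ℝ → Euc d} {J : Set ℝ}
    (hV : ∀ t ∈ J, Orthonormal ℝ fun j => V j t) {m : Fin d} {t₀ : ℝ} (ht₀ : t₀ ∈ J)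
    (hd : ∀ j, j ≠ m → ContDiffWithinAt ℝ 1 (V j) J t₀)
    (hpos : ∀ᶠ t in 𝓝[J] t₀, 0 < ⟪V m t, V m t₀⟫) : ContDiffWithinAt ℝ 1 (V m) J t₀ := by
  let w : ℝ → Euc d := fun t => V m t₀ - ∑ j ∈ Finset.univ.erase m, ⟪V j t, V m t₀⟫ • V j t
  have hw : ContDiffWithinAt ℝ 1 w J t₀ := by
    refine contDiffWithinAt_const.sub (ContDiffWithinAt.sum fun j hj => ?_)
    have := hd j (Finset.ne_of_mem_erase hj)
    exact (this.inner ℝ contDiffWithinAt_const).smul this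
  have hwV : ∀ t ∈ J, w t = ⟪V m t, V m t₀⟫ • V m t := fun t ht =>
    (smul_eq_sub_sum_of_orthonormal (hV t ht) m _).symm
  have hw0 : w t₀ ≠ 0 := by
    rw [hwV t₀ ht₀, real_inner_self_eq_norm_sq, (hV t₀ ht₀).1 m]
    simpa using (hV t₀ ht₀).ne_zero m
  refine (((hw.norm ℝ hw0).inv (norm_ne_zero_iff.2 hw0)).smul hw).congr_of_eventuallyEq_of_mem ?_ ht₀
  filter_upwards [hpos, self_mem_nhdsWithin] with t ht htJ
  have h1 : ‖V m t‖ = 1 := (hV t htJ).1 m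
  simp only [Pi.smul_apply', Pi.inv_apply]
  rw [hwV t htJ, norm_smul, h1, mul_one, smul_smul, Real.norm_of_nonneg ht.le,
    inv_mul_cancel₀ ht.ne', one_smul]

/-- With column `m` replaced by the projected fixed vector `w t`, the determinant is continuous at
`t₀` without any continuity of `V m`, and equals the inner product times the positive frame
determinant. -/
theorem eventually_inner_pos_of_det_pos {d : ℕ} {V : Fin d → ℝ → Euc d} {J : Set ℝ}
    (hV : ∀ t ∈ J, Orthonormal ℝ fun j => V j t) {m : Fin d} {t₀ : ℝ} (ht₀ : t₀ ∈ J)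
    (hd : ∀ j, j ≠ m → ContinuousWithinAt (V j) J t₀)
    (hdet : ∀ t ∈ J, 0 < (Matrix.of (fun i j => V j t i)).det) :
    ∀ᶠ t in 𝓝[J] t₀, 0 < ⟪V m t, V m t₀⟫ := by
  let w : ℝ → Euc d := fun t => V m t₀ - ∑ j ∈ Finset.univ.erase m, ⟪V j t, V m t₀⟫ • V j t
  have hw : ContinuousWithinAt w J t₀ := by
    refine continuousWithinAt_const.sub (tendsto_finsetSum _ fun j hj => ?_)
    have := hd j (Finset.ne_of_mem_erase hj)
    exact (ContinuousWithinAt.inner (𝕜 := ℝ) this continuousWithinAt_const).smul this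
  have hwV : ∀ t ∈ J, w t = ⟪V m t, V m t₀⟫ • V m t := fun t ht =>
    (smul_eq_sub_sum_of_orthonormal (hV t ht) m _).symm
  let M : ℝ → Matrix (Fin d) (Fin d) ℝ := fun t =>
    (Matrix.of (fun i j => V j t i)).updateCol m (w t)
  have hM : ContinuousWithinAt M J t₀ := by
    refine continuousWithinAt_pi.2 fun i => continuousWithinAt_pi.2 fun j => ?_
    by_cases hj : j = m
    · subst hj
      simpa [M, Function.comp_def] using
        (EuclideanSpace.proj (𝕜 := ℝ) i).continuous.continuousAt.comp_continuousWithinAt hw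
    · simpa [M, hj, Function.comp_def] using
        (EuclideanSpace.proj (𝕜 := ℝ) i).continuous.continuousAt.comp_continuousWithinAt (hd j hj)
  have hMdet : ∀ t ∈ J, (M t).det =
      ⟪V m t, V m t₀⟫ * (Matrix.of (fun i j => V j t i)).det := fun t ht => by
    have : (M t) = (Matrix.of (fun i j => V j t i)).updateCol m
        (⟪V m t, V m t₀⟫ • fun i => V m t i) := by
      simp only [M, hwV t ht]; rfl
    rw [this, Matrix.det_updateCol_smul]
    congr 2
    ext i j
    by_cases hj : j = m
    · subst hj; simp
    · simp [hj]
  have hdetc : ContinuousWithinAt (fun t => (M t).det) J t₀ :=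
    (continuous_id.matrix_det (n := Fin d) (R := ℝ)).continuousAt.comp_continuousWithinAt hM
  have h0 : 0 < (M t₀).det := by
    rw [hMdet t₀ ht₀, real_inner_self_eq_norm_sq, (hV t₀ ht₀).1 m]
    simpa using hdet t₀ ht₀
  filter_upwards [hdetc.eventually (lt_mem_nhds h0), self_mem_nhdsWithin] with t ht htJ
  rw [hMdet t htJ] at ht
  exact pos_of_mul_pos_left ht (hdet t htJ).le

namespace IsFrenetFrameOfOrder

variable {n m : ℕ} {f : ℝ → Euc (n + 1)} {J : Set ℝ} {V : Fin (n + 1) → ℝ → Euc (n + 1)}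

theorem contDiffOn_iteratedDerivWithin_succ (hV : IsFrenetFrameOfOrder m f J V)
    (hJ : UniqueDiffOn ℝ J) (i : Fin m) :
    ContDiffOn ℝ 1 (iteratedDerivWithin (i.val + 1) f J) J := by
  refine contDiffOn_iteratedDerivWithin hJ _ 1 (hV.smooth.of_le ?_)
  have : 1 + (i.val + 1) ≤ m + 1 := by omega
  exact_mod_cast this

/-- Only index `m` is neither a Gram–Schmidt vector nor constant. Its local sign is fixed by
continuity if `m < n` and by orientation if `m = n`. -/
theorem contDiffOn (hV : IsFrenetFrameOfOrder m f J V) (hJ : UniqueDiffOn ℝ J)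
    (j : Fin (n + 1)) : ContDiffOn ℝ 1 (V j) J := by
  have hother : ∀ j : Fin (n + 1), j.val ≠ m → ContDiffOn ℝ 1 (V j) J := by
    intro j hj
    rcases lt_or_gt_of_ne hj with h | h
    · exact (contDiffOn_gramSchmidtNormed (hV.contDiffOn_iteratedDerivWithin_succ hJ)
        hV.regular ⟨j.val, h⟩).congr fun t ht => hV.gramSchmidt t ht ⟨j.val, h⟩
    · intro t ht
      exact contDiffWithinAt_const.congr (fun s hs => hV.constant j h s hs t ht) rfl
  by_cases hj : j.val = m
  · intro t₀ ht₀
    have hd : ∀ i, i ≠ j → ContDiffWithinAt ℝ 1 (V i) J t₀ := fun i hi =>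
      hother i (fun h => hi (Fin.ext (h.trans hj.symm))) t₀ ht₀
    refine contDiffWithinAt_of_orthonormal hV.orthonormal ht₀ hd ?_
    rcases hV.le.lt_or_eq with hlt | heq
    · have hc := hV.continuous hlt
      rw [← show j = ⟨m, by omega⟩ from Fin.ext hj] at hc
      have : ContinuousWithinAt (fun t => ⟪V j t, V j t₀⟫) J t₀ :=
        ContinuousWithinAt.inner (𝕜 := ℝ) (hc t₀ ht₀) continuousWithinAt_const
      refine this.eventually (lt_mem_nhds ?_)
      beta_reduce
      rw [real_inner_self_eq_norm_sq, (hV.orthonormal t₀ ht₀).1]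
      norm_num
    · exact eventually_inner_pos_of_det_pos hV.orthonormal ht₀
        (fun i hi => (hd i hi).continuousWithinAt) (hV.oriented heq)
  · exact hother j hj

end IsFrenetFrameOfOrder

/-! ### The first Frenet equation -/

namespace IsFrenetFrameOfOrder

variable {n m : ℕ} {f : ℝ → Euc (n + 1)} {J : Set ℝ} {V : Fin (n + 1) → ℝ → Euc (n + 1)}

theorem hasDerivWithinAt (hV : IsFrenetFrameOfOrder m f J V) (hJ : UniqueDiffOn ℝ J)
    (j : Fin (n + 1)) {t : ℝ} (ht : t ∈ J) :
    HasDerivWithinAt (V j) (derivWithin (V j) J t) J t :=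
  ((hV.contDiffOn hJ j).differentiableOn one_ne_zero t ht).hasDerivWithinAt

theorem inner_derivWithin (hV : IsFrenetFrameOfOrder m f J V) (hJ : UniqueDiffOn ℝ J)
    (i j : Fin (n + 1)) {t : ℝ} (ht : t ∈ J) :
    ⟪V i t, derivWithin (V j) J t⟫ = -⟪derivWithin (V i) J t, V j t⟫ := by
  have h := (hV.hasDerivWithinAt hJ i ht).inner ℝ (hV.hasDerivWithinAt hJ j ht)
  have h' : HasDerivWithinAt (fun s => ⟪V i s, V j s⟫) 0 J t :=
    (hasDerivWithinAt_const t J (if i = j then (1 : ℝ) else 0)).congr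
      (fun s hs => orthonormal_iff_ite.1 (hV.orthonormal s hs) i j)
      (orthonormal_iff_ite.1 (hV.orthonormal t ht) i j)
  have := (hJ t ht).eq_deriv _ h h'
  linarith

theorem derivWithin_ne_zero (hV : IsFrenetFrameOfOrder m f J V) {t : ℝ} (ht : t ∈ J) :
    derivWithin f J t ≠ 0 := by
  have := (hV.regular t ht).ne_zero ⟨0, hV.one_le⟩
  simpa [iteratedDerivWithin_one] using this

theorem derivWithin_eq (hV : IsFrenetFrameOfOrder m f J V) {t : ℝ} (ht : t ∈ J) :
    derivWithin f J t = speed f J t • V 0 t := by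
  have h := hV.gramSchmidt t ht ⟨0, hV.one_le⟩
  have hI : Finset.Iio (⟨0, hV.one_le⟩ : Fin m) = ∅ := by
    ext i
    simp [Fin.lt_def]
  rw [InnerProductSpace.gramSchmidtNormed, InnerProductSpace.gramSchmidt_def, hI,
    Finset.sum_empty, sub_zero, zero_add, iteratedDerivWithin_one] at h
  have hne := norm_ne_zero_iff.2 (hV.derivWithin_ne_zero ht)
  rw [show V 0 t = _ from h, speed]
  simp [smul_smul, hne]

/-- For `m ≥ 2`, `f''` lies in the span of the first two frame vectors, and differentiating `f' = ν
V₁` passes this to `V₁'`. For `m = 1`, `V j` is constant and skew-symmetry suffices. -/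
theorem inner_derivWithin_zero (hV : IsFrenetFrameOfOrder m f J V) (hJ : UniqueDiffOn ℝ J)
    {j : Fin (n + 1)} (hj : 2 ≤ j.val) {t : ℝ} (ht : t ∈ J) :
    ⟪derivWithin (V 0) J t, V j t⟫ = 0 := by
  have hj0 : (0 : Fin (n + 1)) ≠ j := fun h => by simp [← h] at hj
  by_cases hm : m = 1
  · have h0 : derivWithin (V j) J t = 0 := by
      rw [derivWithin_congr (f := fun _ => V j t)
        (fun s hs => hV.constant j (by omega) s hs t ht) rfl]
      simp
    have := hV.inner_derivWithin hJ 0 j ht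
    rw [h0, inner_zero_right] at this
    linarith
  have hm2 : 1 < m := by have := hV.one_le; omega
  have hu : HasDerivWithinAt (derivWithin f J) (iteratedDerivWithin 2 f J t) J t := by
    have h1 : iteratedDerivWithin 1 f J = derivWithin f J :=
      iteratedDerivWithin_one
    have h2 := (((hV.contDiffOn_iteratedDerivWithin_succ hJ ⟨0, hV.one_le⟩).differentiableOn
      one_ne_zero) t ht).hasDerivWithinAt
    rw [← iteratedDerivWithin_succ] at h2
    simpa [h1] using h2
  -- The speed is differentiated in the form `⟪V₁, f'⟫`.
  have hφ := (hV.hasDerivWithinAt hJ 0 ht).inner ℝ hu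
  have hval : ∀ s ∈ J, ⟪V 0 s, derivWithin f J s⟫ = speed f J s := fun s hs => by
    rw [hV.derivWithin_eq hs, inner_smul_right, real_inner_self_eq_norm_sq,
      (hV.orthonormal s hs).1]
    ring
  have heq : ∀ s ∈ J, derivWithin f J s = ⟪V 0 s, derivWithin f J s⟫ • V 0 s := fun s hs => by
    rw [hval s hs]
    exact hV.derivWithin_eq hs
  have hacc := (hJ t ht).eq_deriv _ hu ((hφ.smul (hV.hasDerivWithinAt hJ 0 ht)).congr heq
    (heq t ht))
  have hspan : ⟪iteratedDerivWithin 2 f J t, V j t⟫ = 0 := by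
    have hmem := InnerProductSpace.mem_span_gramSchmidt ℝ
      (fun k : Fin m => iteratedDerivWithin (k.val + 1) f J t) (le_refl ⟨1, hm2⟩)
    rw [← InnerProductSpace.span_gramSchmidtNormed] at hmem
    have hle : Submodule.span ℝ (InnerProductSpace.gramSchmidtNormed ℝ
        (fun k : Fin m => iteratedDerivWithin (k.val + 1) f J t) '' Iic ⟨1, hm2⟩) ≤
        (Submodule.span ℝ {V j t})ᗮ := by
      rw [Submodule.span_le]
      rintro _ ⟨i, hi, rfl⟩
      rw [SetLike.mem_coe, Submodule.mem_orthogonal_singleton_iff_inner_left,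
        ← hV.gramSchmidt t ht i]
      refine (hV.orthonormal t ht).2 fun h => ?_
      have h1 : i.val ≤ 1 := hi
      have h2 : i.val = j.val := congrArg Fin.val h
      omega
    exact Submodule.mem_orthogonal_singleton_iff_inner_left.1 (hle hmem)
  rw [hacc, inner_add_left, inner_smul_left, inner_smul_left, (hV.orthonormal t ht).2 hj0,
    hval t ht] at hspan
  have hpos : speed f J t ≠ 0 := norm_ne_zero_iff.2 (hV.derivWithin_ne_zero ht)
  simpa [hpos] using hspan

end IsFrenetFrameOfOrder

/-! ### Differential of the tube map -/

theorem exists_linearIsometry_of_orthonormal {k : ℕ} {F : Type*} [NormedAddCommGroup F]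
    [InnerProductSpace ℝ F] {v : Fin k → F} (hv : Orthonormal ℝ v) :
    ∃ W : Euc k →ₗᵢ[ℝ] F, ∀ x, W x = ∑ j, x j • v j := by
  refine ⟨⟨{ toFun := fun x => ∑ j, x j • v j
             map_add' := fun x y => by simp [add_smul, Finset.sum_add_distrib]
             map_smul' := fun r x => by simp [mul_smul, Finset.smul_sum] }, fun x => ?_⟩,
    fun x => rfl⟩
  rw [← sq_eq_sq₀ (norm_nonneg _) (norm_nonneg _), ← real_inner_self_eq_norm_sq,
    EuclideanSpace.real_norm_sq_eq]
  have := hv.inner_sum (fun j => x j) (fun j => x j) Finset.univ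
  simpa [pow_two] using this

/-- The Jacobian of `tubeMap` along a sphere tube. -/
noncomputable def tubeJacobian {k : ℕ} (f : ℝ → Euc (k + 1 + 1)) (J : Set ℝ)
    (V : Fin (k + 1 + 1) → ℝ → Euc (k + 1 + 1)) (z : Euc (k + 1) × ℝ) : ℝ :=
  speed f J z.2 - z.1 0 * ⟪derivWithin (V 0) J z.2, V 1 z.2⟫

theorem hasStrictFDerivAt_tubeMap {k : ℕ} {f : ℝ → Euc (k + 1 + 1)}
    {V : Fin (k + 1 + 1) → ℝ → Euc (k + 1 + 1)} {z : Euc (k + 1) × ℝ} {f' : Euc (k + 1 + 1)}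
    {V' : Fin (k + 1 + 1) → Euc (k + 1 + 1)} (hf : HasStrictDerivAt f f' z.2)
    (hV : ∀ j, HasStrictDerivAt (V j) (V' j) z.2) (W : Euc (k + 1) →ₗᵢ[ℝ] Euc (k + 1 + 1))
    (hW : ∀ x, W x = ∑ j, x j • V j.succ z.2) :
    HasStrictFDerivAt (tubeMap f V) (W.toContinuousLinearMap.comp (.fst ℝ _ _) +
      (ContinuousLinearMap.snd ℝ (Euc (k + 1)) ℝ).smulRight (f' + ∑ j, z.1 j • V' j.succ)) z := by
  have hsnd : HasStrictFDerivAt (fun q : Euc (k + 1) × ℝ => q.2) (.snd ℝ (Euc (k + 1)) ℝ) z :=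
    hasStrictFDerivAt_snd
  have hcoord : ∀ j, HasStrictFDerivAt (fun q : Euc (k + 1) × ℝ => q.1 j)
      ((EuclideanSpace.proj j : Euc (k + 1) →L[ℝ] ℝ).comp (.fst ℝ (Euc (k + 1)) ℝ)) z := fun j =>
    ((EuclideanSpace.proj j : Euc (k + 1) →L[ℝ] ℝ).comp (.fst ℝ (Euc (k + 1)) ℝ)).hasStrictFDerivAt
  have h := (hf.hasStrictFDerivAt.comp z hsnd).add (HasStrictFDerivAt.fun_sum (u := Finset.univ)
    fun (j : Fin (k + 1)) _ => (hcoord j).smul ((hV j.succ).hasStrictFDerivAt.comp z hsnd))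
  refine h.congr_fderiv ?_
  ext h <;> simp [hW, Finset.sum_add_distrib, Finset.smul_sum]

namespace IsFrenetFrameOfOrder

variable {k m : ℕ} {f : ℝ → Euc (k + 1 + 1)} {J : Set ℝ}
  {V : Fin (k + 1 + 1) → ℝ → Euc (k + 1 + 1)}

theorem contDiffOn_curve (hV : IsFrenetFrameOfOrder m f J V) : ContDiffOn ℝ 1 f J :=
  hV.smooth.of_le (by exact_mod_cast (by omega : 1 ≤ m + 1))

/-- The velocity of `tubeMap` in the direction of the axis: its component orthogonal to the
normal space is `tubeJacobian`, and its normal component is tangent to the sphere. -/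
theorem exists_hasStrictFDerivAt_tubeMap (hV : IsFrenetFrameOfOrder m f J V)
    (hJ : UniqueDiffOn ℝ J) {z : Euc (k + 1) × ℝ} (hz : J ∈ 𝓝 z.2) :
    ∃ (W : Euc (k + 1) →ₗᵢ[ℝ] Euc (k + 1 + 1)) (c : Euc (k + 1)) (y : Euc (k + 1 + 1)),
      HasStrictFDerivAt (tubeMap f V) (W.toContinuousLinearMap.comp (.fst ℝ _ _) +
        (ContinuousLinearMap.snd ℝ (Euc (k + 1)) ℝ).smulRight (W c + y)) z ∧
      ⟪z.1, c⟫ = 0 ∧ (∀ v, ⟪W v, y⟫ = 0) ∧ y = tubeJacobian f J V z • V 0 z.2 := by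
  have ht : z.2 ∈ J := mem_of_mem_nhds hz
  have hon := hV.orthonormal z.2 ht
  have hsucc : Orthonormal ℝ fun j : Fin (k + 1) => V j.succ z.2 :=
    hon.comp _ (Fin.succ_injective _)
  obtain ⟨W, hW⟩ := exists_linearIsometry_of_orthonormal hsucc
  have hf : HasStrictDerivAt f (derivWithin f J z.2) z.2 := by
    rw [derivWithin_of_mem_nhds hz]
    exact ((hV.contDiffOn_curve z.2 ht).contDiffAt hz).hasStrictDerivAt one_ne_zero
  have hVd : ∀ j, HasStrictDerivAt (V j) (derivWithin (V j) J z.2) z.2 := fun j => by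
    rw [derivWithin_of_mem_nhds hz]
    exact ((hV.contDiffOn hJ j z.2 ht).contDiffAt hz).hasStrictDerivAt one_ne_zero
  have hG := hasStrictFDerivAt_tubeMap hf hVd W hW
  set w := derivWithin f J z.2 + ∑ j, z.1 j • derivWithin (V j.succ) J z.2 with hw
  obtain ⟨b, hb⟩ := exists_orthonormalBasis_of_orthonormal hon
  let c : Euc (k + 1) := WithLp.toLp 2 fun j => ⟪V j.succ z.2, w⟫
  have hdec : w = W c + ⟪V 0 z.2, w⟫ • V 0 z.2 := by
    have := b.sum_repr' w
    simp only [hb] at this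
    rw [Fin.sum_univ_succ] at this
    rw [hW]
    exact this.symm.trans (add_comm _ _)
  have h0 : ⟪V 0 z.2, w⟫ = tubeJacobian f J V z := by
    rw [hw, inner_add_right, inner_sum, hV.derivWithin_eq ht, inner_smul_right,
      real_inner_self_eq_norm_sq, hon.1, tubeJacobian, Finset.sum_eq_single 0]
    · rw [inner_smul_right, hV.inner_derivWithin hJ _ _ ht, Fin.succ_zero_eq_one]
      ring
    · intro j _ hj
      have hj2 : 2 ≤ j.succ.val := by
        have := Fin.pos_iff_ne_zero.2 hj
        rw [Fin.val_succ]
        exact Nat.succ_le_succ this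
      rw [inner_smul_right, hV.inner_derivWithin hJ _ _ ht, hV.inner_derivWithin_zero hJ hj2 ht]
      simp
    · simp
  -- With `Y = ∑ xⱼ Vⱼ₊₁` for fixed `X`, this is `⟪Y, f' + Y'⟫ = 0`: `Y` has constant norm and is
  -- normal to `f'`.
  have hc : ⟪z.1, c⟫ = 0 := by
    let Y : ℝ → Euc (k + 1 + 1) := fun t => ∑ j : Fin (k + 1), z.1 j • V j.succ t
    have hY : HasDerivWithinAt Y (∑ j, z.1 j • derivWithin (V j.succ) J z.2) J z.2 :=
      HasDerivWithinAt.fun_sum fun j _ => (hV.hasDerivWithinAt hJ j.succ ht).fun_const_smul _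
    have hnorm : ∀ s ∈ J, ⟪Y s, Y s⟫ = ‖z.1‖ ^ 2 := fun s hs => by
      obtain ⟨Ws, hWs⟩ := exists_linearIsometry_of_orthonormal
        ((hV.orthonormal s hs).comp _ (Fin.succ_injective (k + 1)))
      have : Y s = Ws z.1 := (hWs _).symm
      rw [this, real_inner_self_eq_norm_sq, Ws.norm_map]
    have hd := (hJ z.2 ht).eq_deriv _ (hY.inner ℝ hY)
      ((hasDerivWithinAt_const z.2 J (‖z.1‖ ^ 2)).congr hnorm (hnorm _ ht))
    have hYf : ⟪Y z.2, derivWithin f J z.2⟫ = 0 := by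
      rw [hV.derivWithin_eq ht, inner_smul_right, sum_inner, Finset.sum_eq_zero, mul_zero]
      intro j _
      rw [inner_smul_left, hon.2 (Fin.succ_ne_zero j), mul_zero]
    have hYw : ⟪z.1, c⟫ = ⟪Y z.2, w⟫ := by
      rw [sum_inner, PiLp.inner_apply]
      refine Finset.sum_congr rfl fun j _ => ?_
      rw [inner_smul_left]
      simp [c, mul_comm]
    rw [hYw, hw, inner_add_right, hYf]
    rw [real_inner_comm (Y z.2)] at hd
    linarith [real_inner_comm (Y z.2) (∑ j, z.1 j • derivWithin (V j.succ) J z.2)]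
  refine ⟨W, c, tubeJacobian f J V z • V 0 z.2, ?_, hc, fun v => ?_, rfl⟩
  · rw [h0] at hdec
    rwa [hdec] at hG
  · rw [inner_smul_right, hW, sum_inner, Finset.sum_eq_zero, mul_zero]
    intro j _
    rw [inner_smul_left, hon.2 (Fin.succ_ne_zero j), mul_zero]

theorem continuousOn_tubeMap (hV : IsFrenetFrameOfOrder m f J V) (hJ : UniqueDiffOn ℝ J) :
    ContinuousOn (tubeMap f V) (univ ×ˢ J) := by
  have hmaps : MapsTo Prod.snd ((univ : Set (Euc (k + 1))) ×ˢ J) J := fun z hz => hz.2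
  refine (hV.contDiffOn_curve.continuousOn.comp continuousOn_snd hmaps).add
    (continuousOn_finsetSum _ fun j _ => ContinuousOn.fun_smul ?_
      ((hV.contDiffOn hJ j.succ).continuousOn.comp continuousOn_snd hmaps))
  exact ((EuclideanSpace.proj (𝕜 := ℝ) j).continuous.comp continuous_fst).continuousOn

theorem continuousOn_speed (hV : IsFrenetFrameOfOrder m f J V) (hJ : UniqueDiffOn ℝ J) :
    ContinuousOn (speed f J) J :=
  (hV.contDiffOn_curve.continuousOn_derivWithin hJ le_rfl).norm

theorem continuousOn_tubeJacobian (hV : IsFrenetFrameOfOrder m f J V) (hJ : UniqueDiffOn ℝ J) :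
    ContinuousOn (tubeJacobian f J V) (univ ×ˢ J) := by
  have hmaps : MapsTo Prod.snd ((univ : Set (Euc (k + 1))) ×ˢ J) J := fun z hz => hz.2
  refine ((hV.continuousOn_speed hJ).comp continuousOn_snd hmaps).sub (ContinuousOn.mul ?_
    (ContinuousOn.inner (𝕜 := ℝ)
      (((hV.contDiffOn hJ 0).continuousOn_derivWithin hJ le_rfl).comp continuousOn_snd hmaps)
      ((hV.contDiffOn hJ 1).continuousOn.comp continuousOn_snd hmaps)))
  exact ((EuclideanSpace.proj (𝕜 := ℝ) (0 : Fin (k + 1))).continuous.comp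
    continuous_fst).continuousOn

/-- A slice is an isometric copy of a sphere of finite `k`-volume, hence null one dimension higher.
This disposes of the end slices of the tube. -/
theorem volume_tubeMap_slice (hV : IsFrenetFrameOfOrder m f J V) {R t : ℝ} (hR : 0 < R)
    (ht : t ∈ J) :
    μHE[k + 1] (tubeMap f V '' (Metric.sphere (0 : Euc (k + 1)) R ×ˢ {t})) = 0 := by
  obtain ⟨W, hW⟩ := exists_linearIsometry_of_orthonormal
    ((hV.orthonormal t ht).comp _ (Fin.succ_injective (k + 1)))
  have h := euclideanHausdorffMeasure_image_le_of_dist_le (tubeMap f V) Prod.fst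
    (Metric.sphere (0 : Euc (k + 1)) R ×ˢ {t}) 1 (k + 1) fun z hz z' hz' => by
      have hz2 : z.2 = t := hz.2
      have hz2' : z'.2 = t := hz'.2
      have hG : ∀ u : Euc (k + 1) × ℝ, u.2 = t → tubeMap f V u = f t + W u.1 := fun u hu => by
        rw [hW, tubeMap, hu]
        rfl
      rw [hG z hz2, hG z' hz2', dist_add_left, W.dist_map]
      simp
  have h0 : μHE[k + 1] (Metric.sphere (0 : Euc (k + 1)) R) = 0 :=
    (Measure.euclideanHausdorffMeasure_zero_or_top (Nat.lt_succ_self k) _).resolve_right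
      (euclideanHausdorffMeasure_sphere_lt_top hR).ne
  refine le_antisymm (h.trans ?_) zero_le
  rw [fst_image_prod _ (singleton_nonempty t), h0, mul_zero]

end IsFrenetFrameOfOrder

/-! ### Integration over the sphere and conclusion -/

/-- The linear terms cancel in the integral of an affine function over a sphere. -/
theorem lintegral_sphere_affine {k : ℕ} {R : ℝ} {p r : ℝ}
    (h : ∀ X ∈ Metric.sphere (0 : Euc (k + 1)) R, 0 < p - X 0 * r) :
    ∫⁻ X in Metric.sphere (0 : Euc (k + 1)) R, ENNReal.ofReal (p - X 0 * r) ∂μHE[k] =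
      μHE[k] (Metric.sphere (0 : Euc (k + 1)) R) * ENNReal.ofReal p := by
  have hS : MeasurableSet (Metric.sphere (0 : Euc (k + 1)) R) :=
    Metric.isClosed_sphere.measurableSet
  have hmeas : Measurable fun X : Euc (k + 1) => ENNReal.ofReal (p - X 0 * r) := by fun_prop
  have hneg : MeasurePreserving (fun X : Euc (k + 1) => -X) μHE[k] μHE[k] :=
    (LinearIsometryEquiv.neg ℝ (E := Euc (k + 1))).toIsometryEquiv
      |>.measurePreserving_euclideanHausdorffMeasure k
  have hpre : (fun X : Euc (k + 1) => -X) ⁻¹' Metric.sphere 0 R = Metric.sphere 0 R := by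
    ext X
    simp
  have hrefl : ∫⁻ X in Metric.sphere (0 : Euc (k + 1)) R, ENNReal.ofReal (p + X 0 * r) ∂μHE[k] =
      ∫⁻ X in Metric.sphere (0 : Euc (k + 1)) R, ENNReal.ofReal (p - X 0 * r) ∂μHE[k] := by
    rw [← hneg.setLIntegral_comp_preimage hS hmeas, hpre]
    simp
  have hsum : ∫⁻ X in Metric.sphere (0 : Euc (k + 1)) R, ENNReal.ofReal (p - X 0 * r) ∂μHE[k] +
      ∫⁻ X in Metric.sphere (0 : Euc (k + 1)) R, ENNReal.ofReal (p + X 0 * r) ∂μHE[k] =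
      2 * (μHE[k] (Metric.sphere (0 : Euc (k + 1)) R) * ENNReal.ofReal p) := by
    rw [← lintegral_add_left hmeas, mul_left_comm, mul_comm, ← setLIntegral_const]
    refine setLIntegral_congr_fun hS fun X hX => ?_
    have h1 := h X hX
    -- Positivity at both antipodes is needed, as `ENNReal.ofReal` is additive only on nonnegative
    -- terms.
    have h2 := h (-X) (by simpa using hX)
    simp only [PiLp.neg_apply, neg_mul, sub_neg_eq_add] at h2
    beta_reduce
    rw [← ENNReal.ofReal_add h1.le h2.le, two_mul (ENNReal.ofReal p),
      ← ENNReal.ofReal_add (by linarith) (by linarith)]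
    congr 1
    ring
  rw [hrefl, ← two_mul] at hsum
  exact (ENNReal.mul_right_inj two_ne_zero (by simp)).1 hsum

theorem sphereTube_const {k : ℕ} (f : ℝ → Euc (k + 1 + 1)) (V : Fin (k + 1 + 1) → ℝ → Euc (k + 1 + 1))
    {R : ℝ} (hR : 0 < R) (a b : ℝ) :
    sphereTube f V (fun _ => R) a b =
      tubeMap f V '' (Metric.sphere (0 : Euc (k + 1)) R ×ˢ Icc a b) := by
  rw [sphereTube]
  congr 1
  ext ⟨Y, t⟩
  constructor
  · rintro ⟨X, hX, s, hs, h⟩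
    obtain ⟨rfl, rfl⟩ := Prod.mk.inj h
    refine ⟨?_, hs⟩
    rw [mem_sphere_zero_iff_norm] at hX ⊢
    rw [norm_smul, hX, mul_one, Real.norm_of_nonneg hR.le]
  · rintro ⟨hY, ht⟩
    rw [mem_sphere_zero_iff_norm] at hY
    refine ⟨R⁻¹ • Y, ?_, t, ht, ?_⟩
    · rw [mem_sphere_zero_iff_norm, norm_smul, hY, norm_inv, Real.norm_of_nonneg hR.le,
        inv_mul_cancel₀ hR.ne']
    · rw [smul_inv_smul₀ hR.ne']

theorem kVolume_sphereTube {k m : ℕ} {J : Set ℝ} (hJ : J.OrdConnected) {a b : ℝ} (hab : a < b)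
    (hI : Icc a b ⊆ J) {f : ℝ → Euc (k + 1 + 1)} {V : Fin (k + 1 + 1) → ℝ → Euc (k + 1 + 1)}
    (hV : IsFrenetFrameOfOrder m f J V) {R : ℝ} (hR : 0 < R)
    (hinj : IsGenuine f V (fun _ => R) a b)
    (hreg : FundamentalRegularity f J V (fun _ => R) a b) :
    kVolume (k + 1) (sphereTube f V (fun _ => R) a b) =
      kVolume k (Metric.sphere (0 : Euc (k + 1)) R) * ENNReal.ofReal (arcLength f J a b) := by
  have hud : UniqueDiffOn ℝ J := by
    refine uniqueDiffOn_convex hJ.convex ⟨(a + b) / 2, interior_mono (Ioo_subset_Icc_self.trans hI) ?_⟩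
    rw [interior_Ioo]
    constructor <;> linarith
  have hnhds : ∀ t ∈ Ioo a b, J ∈ 𝓝 t := fun t ht =>
    mem_of_superset (Icc_mem_nhds ht.1 ht.2) hI
  have hIJ : Ioo a b ⊆ J := Ioo_subset_Icc_self.trans hI
  have hDJ : Metric.sphere (0 : Euc (k + 1)) R ×ˢ Ioo a b ⊆ univ ×ˢ J :=
    prod_mono (subset_univ _) hIJ
  have hjac : ∀ X ∈ Metric.sphere (0 : Euc (k + 1)) R, ∀ t ∈ Ioo a b,
      0 < tubeJacobian f J V (X, t) := fun X hX t ht => by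
    have h := hreg (X, t) ⟨(mem_sphere_zero_iff_norm.1 hX).le, Ioo_subset_Icc_self ht⟩
    have hpos : speed f J t ≠ 0 := norm_ne_zero_iff.2 (hV.derivWithin_ne_zero (hIJ ht))
    have heq : speed f J t * (1 - X 0 * frenetCurvature f J V 0 t) =
        tubeJacobian f J V (X, t) := by
      rw [tubeJacobian, frenetCurvature, Fin.castSucc_zero, Fin.succ_zero_eq_one]
      field_simp
    rw [← heq]
    exact h
  have hDdisk : Metric.sphere (0 : Euc (k + 1)) R ×ˢ Ioo a b ⊆
      diskSolid (k + 1) (fun _ => R) a b := fun z hz =>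
    ⟨(mem_sphere_zero_iff_norm.1 hz.1).le, Ioo_subset_Icc_self hz.2⟩
  have harea := volume_image_sphere_prod (G := tubeMap f V) hR measurableSet_Ioo
    (U := Ioo a b) (lam := tubeJacobian f J V)
    (hinj.mono hDdisk)
    ((hV.continuousOn_tubeMap hud).mono hDJ) ((hV.continuousOn_tubeJacobian hud).mono hDJ)
    (fun z hz => hjac z.1 hz.1 z.2 hz.2) fun z hz => by
      obtain ⟨W, c, y, hG, hc, hy, hyl⟩ := hV.exists_hasStrictFDerivAt_tubeMap hud
        (hnhds z.2 hz.2)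
      refine ⟨W, c, y, hG, hc, hy, ?_⟩
      rw [hyl, norm_smul, (hV.orthonormal _ (hIJ hz.2)).1, mul_one,
        Real.norm_of_nonneg (hjac z.1 hz.1 z.2 hz.2).le]
  -- The points `a`, `b` may be endpoints of `J`, where two-sided strict differentiability is
  -- unavailable.
  have hends : μHE[k + 1] (tubeMap f V '' (Metric.sphere (0 : Euc (k + 1)) R ×ˢ Icc a b)) =
      μHE[k + 1] (tubeMap f V '' (Metric.sphere (0 : Euc (k + 1)) R ×ˢ Ioo a b)) := by
    rw [← Ioo_union_both hab.le, ← singleton_union, prod_union, prod_union, image_union,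
      image_union]
    refine measure_congr (union_ae_eq_left_of_ae_eq_empty (ae_eq_empty.2 (measure_union_null ?_ ?_)))
    · exact hV.volume_tubeMap_slice hR (hI (left_mem_Icc.2 hab.le))
    · exact hV.volume_tubeMap_slice hR (hI (right_mem_Icc.2 hab.le))
  have : IsFiniteMeasure ((μHE[k] : Measure (Euc (k + 1))).restrict (Metric.sphere 0 R)) :=
    ⟨by simpa using euclideanHausdorffMeasure_sphere_lt_top hR⟩
  have hmeas : AEMeasurable (fun z => ENNReal.ofReal (tubeJacobian f J V z))
      ((sphereProdMeasure k R).restrict (Metric.sphere 0 R ×ˢ Ioo a b)) :=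
    (((hV.continuousOn_tubeJacobian hud).mono hDJ).aemeasurable
      (Metric.isClosed_sphere.measurableSet.prod measurableSet_Ioo)).ennreal_ofReal
  have hprod : (sphereProdMeasure k R).restrict (Metric.sphere 0 R ×ˢ Ioo a b) =
      ((μHE[k] : Measure (Euc (k + 1))).restrict (Metric.sphere 0 R)).prod
        (volume.restrict (Ioo a b)) := by
    rw [sphereProdMeasure, ← Measure.prod_restrict, Measure.restrict_restrict
      Metric.isClosed_sphere.measurableSet, inter_self]
  have hspeed : IntegrableOn (speed f J) (Ioo a b) :=
    (((hV.continuousOn_speed hud).mono hI).integrableOn_Icc).mono_set Ioo_subset_Icc_self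
  rw [kVolume, kVolume, sphereTube_const f V hR, hends, harea, hprod]
  rw [hprod] at hmeas
  rw [lintegral_prod_symm _ hmeas, arcLength, intervalIntegral.integral_of_le hab.le,
    integral_Ioc_eq_integral_Ioo, ofReal_integral_eq_lintegral_ofReal hspeed
      (Eventually.of_forall fun t => norm_nonneg _),
    ← lintegral_const_mul' _ _ (euclideanHausdorffMeasure_sphere_lt_top hR).ne]
  refine setLIntegral_congr_fun measurableSet_Ioo fun t ht => ?_
  exact lintegral_sphere_affine (p := speed f J t)
    (r := ⟪derivWithin (V 0) J t, V 1 t⟫) fun X hX => hjac X hX t ht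

theorem mainTheorem8 (n : ℕ) [NeZero n] (J : Set ℝ) (hJ : J.OrdConnected)
    (a b : ℝ) (hab : a < b) (hI : Icc a b ⊆ J)
    (f : ℝ → Euc (n + 1)) (V : Fin (n + 1) → ℝ → Euc (n + 1)) (hV : IsFrenetFrame f J V)
    (R : ℝ) (hR : 0 < R)
    (hinj : IsGenuine f V (fun _ => R) a b)
    (hreg : FundamentalRegularity f J V (fun _ => R) a b) :
    kVolume n (sphereTube f V (fun _ => R) a b) =
      kVolume (n - 1) (Metric.sphere (0 : Euc n) R) * ENNReal.ofReal (arcLength f J a b) := by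
  -- Writing `n = k + 1` removes the truncated subtraction; for `k = 0` the sphere is a pair of
  -- points, with no separate treatment.
  obtain ⟨k, rfl⟩ := Nat.exists_eq_succ_of_ne_zero (NeZero.ne n)
  obtain ⟨m, hm⟩ := hV
  exact kVolume_sphereTube hJ hab hI hm hR hinj hreg
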